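/- Let $R$ be a commutative quantale: a complete lattice with a commutative monoid structure $(R,\cdot,1)$ whose multiplication preserves arbitrary joins in each variable. Write $\sum$ and $+$ for joins and $0$ for the least element. An *$R$-matrix* on a set $X$ is a function $M : X\times X\to R$. A morphism from $M$ on $X$ to $N$ on $Y$ is a function $f : X\to Y$ with $f_*(M)\le N$ pointwise, where $f_*(M)(y,y')=\sum_{f(x)=y,\,f(x')=y'}M(x,x')$. This defines the category $\mathsf{RMat}$. Let $\mathsf{RCat}$ be its full subcategory of those $C$ with $1\le C(x,x)$ and $C(x,y)\,C(y,z)\le C(x,z)$ for all $x,y,z$, and let $U:\mathsf{RCat}\to\mathsf{RMat}$ be the inclusion. The algebraic path problem functor $F:\mathsf{RMat}\to\mathsf{RCat}$ is $F(M)=\sum_{n\ge 0}M^n$ (matrix powers, $M^0$ the identity matrix), and it keeps underlying functions. For a set $X$ let $0_X\in\mathsf{RMat}$ be the matrix with all entries $0$ and $1_X\in\mathsf{RCat}$ the identity matrix, which has $1$ on the diagonal and $0$ elsewhere. Both are functorial in $X$, and $1_X\cong F(0_X)$ naturally in $X$, via the identity function. $\mathsf{Open}(\mathsf{RMat})$ is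 the following symmetric monoidal (pseudo) double category. - Objects are sets and vertical morphisms are functions. - Horizontal arrows $X\to Y$ are cospans $0_X\to M\leftarrow 0_Y$ in $\mathsf{RMat}$. - A 2-morphism from $0_X\to M\leftarrow 0_Y$ to $0_{X'}\to M'\leftarrow 0_{Y'}$ is a triple $(f,g,h)$, with functions $f:X\to X'$ and $h:Y\to Y'$ and a morphism $g:M\to M'$, such that the two resulting squares commute. - Horizontal composition is by pushout: if $a,b$ are the maps from the vertex sets of $M$ and $N$ to the pushout of these sets over the shared boundary, the apex of the composite is $a_*(M)+b_*(N)$. The horizontal identity on $X$ is $0_X=0_X=0_X$. - The monoidal product is disjoint union of sets and coproduct of matrices. $\mathsf{Open}(\mathsf{RCat})$ is the same construction with $\mathsf{RCat}$ in place of $\mathsf{RMat}$ and $1_X$ in place of $0_X$. Pushouts and coproducts are now taken in $\mathsf{RCat}$. The pushout of $C$ and $D$ has apex $F(a_*(UC)+b_*(UD))$, and the coproduct of $C$ and $D$ is the coproduct of matrices. **Theorem.** There is a (strong) symmetric monoidal double functor $$\bigstar:\mathsf{Open}(\mathsf{RMat})\to\mathsf{Open}(\mathsf{RCat})$$ such that: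 1. $\bigstar$ is the identity on objects and on vertical morphisms; 2. $\bigstar$ sends an open $R$-matrix $0_X\xrightarrow{\,l\,}M\xleftarrow{\,r\,}0_Y$ to the open $R$-category $1_X\cong F(0_X)\xrightarrow{F(l)}F(M)\xleftarrow{F(r)}F(0_Y)\cong 1_Y$; 3. $\bigstar$ sends a 2-morphism $(f,g,h)$ to $(f,F(g),h)$. In particular, $\bigstar$ comes with: - natural globular isomorphisms $\bigstar(M)\odot\bigstar(N)\cong\bigstar(M\odot N)$, for $M,N$ horizontally composable, and $U_X\cong\bigstar(U_X)$, where $\odot$ is horizontal composition and $U_X$ the horizontal identity on $X$, coherent with the associators and unitors of horizontal composition; - natural isomorphisms $\bigstar(M)\otimes\bigstar(N)\cong\bigstar(M\otimes N)$ and $I\cong\bigstar(I)$, where $\otimes$ is the monoidal product and $I$ is its unit (on objects, and the horizontal identity on it), coherent with the associators, unitors and braidings of the monoidal structures. The two families are compatible with each other and with the interchange of $\odot$ and $\otimes$. -/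

import Mathlib

set_option linter.checkUnivs false

open CategoryTheory MonoidalCategory

universe u v w u₀ v₀ u₁ v₁ u₂ v₂ u₃ v₃

/-- A horizontal arrow of a double category, bundled with its source and target. -/
structure HorArrow {O : Type u₀} (H : O → O → Type u₁) where
  {src tgt : O}
  arr : H src tgt

local notation "⟪" M "⟫" => HorArrow.mk M

/-- A (pseudo) double category: a category `Obj` of objects and vertical morphisms, a category of
horizontal arrows and 2-cells (with `M ⟶ N` the cells from `M` down to `N`), strict source and
target functors, a horizontal unit functor and a horizontal composition functor (in diagrammatic
order), and globular associativity and unit isomorphisms satisfying pentagon and triangle.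

Two cells can be composed horizontally when their common vertical boundary agrees; the laws are
quantified over all proofs of such agreements. -/
structure DoubleCategory where
  Obj : Type u₀
  [vertCat : Category.{v₀} Obj]
  Hor : Obj → Obj → Type u₁
  [cellCat : Category.{v₁} (HorArrow Hor)]
  -- source and target functors
  srcMap : ∀ {X Y X' Y' : Obj} {M : Hor X Y} {M' : Hor X' Y'}, (⟪M⟫ ⟶ ⟪M'⟫) → (X ⟶ X')
  tgtMap : ∀ {X Y X' Y' : Obj} {M : Hor X Y} {M' : Hor X' Y'}, (⟪M⟫ ⟶ ⟪M'⟫) → (Y ⟶ Y')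
  srcMap_id : ∀ {X Y : Obj} (M : Hor X Y), srcMap (𝟙 ⟪M⟫) = 𝟙 X
  tgtMap_id : ∀ {X Y : Obj} (M : Hor X Y), tgtMap (𝟙 ⟪M⟫) = 𝟙 Y
  srcMap_comp : ∀ {X Y X' Y' X'' Y'' : Obj} {M : Hor X Y} {M' : Hor X' Y'} {M'' : Hor X'' Y''}
    (α : ⟪M⟫ ⟶ ⟪M'⟫) (β : ⟪M'⟫ ⟶ ⟪M''⟫), srcMap (α ≫ β) = srcMap α ≫ srcMap β
  tgtMap_comp : ∀ {X Y X' Y' X'' Y'' : Obj} {M : Hor X Y} {M' : Hor X' Y'} {M'' : Hor X'' Y''}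
    (α : ⟪M⟫ ⟶ ⟪M'⟫) (β : ⟪M'⟫ ⟶ ⟪M''⟫), tgtMap (α ≫ β) = tgtMap α ≫ tgtMap β
  -- horizontal units
  hid : ∀ X : Obj, Hor X X
  hidMap : ∀ {X Y : Obj}, (X ⟶ Y) → (⟪hid X⟫ ⟶ ⟪hid Y⟫)
  srcMap_hidMap : ∀ {X Y : Obj} (f : X ⟶ Y), srcMap (hidMap f) = f
  tgtMap_hidMap : ∀ {X Y : Obj} (f : X ⟶ Y), tgtMap (hidMap f) = f
  hidMap_id : ∀ X : Obj, hidMap (𝟙 X) = 𝟙 ⟪hid X⟫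
  hidMap_comp : ∀ {X Y Z : Obj} (f : X ⟶ Y) (g : Y ⟶ Z), hidMap (f ≫ g) = hidMap f ≫ hidMap g
  -- horizontal composition
  hcomp : ∀ {X Y Z : Obj}, Hor X Y → Hor Y Z → Hor X Z
  hcompMap : ∀ {X Y Z X' Y' Z' : Obj} {M : Hor X Y} {N : Hor Y Z} {M' : Hor X' Y'} {N' : Hor Y' Z'}
    (α : ⟪M⟫ ⟶ ⟪M'⟫) (β : ⟪N⟫ ⟶ ⟪N'⟫), tgtMap α = srcMap β → (⟪hcomp M N⟫ ⟶ ⟪hcomp M' N'⟫)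
  srcMap_hcompMap : ∀ {X Y Z X' Y' Z' : Obj} {M : Hor X Y} {N : Hor Y Z} {M' : Hor X' Y'}
    {N' : Hor Y' Z'} (α : ⟪M⟫ ⟶ ⟪M'⟫) (β : ⟪N⟫ ⟶ ⟪N'⟫) (h : tgtMap α = srcMap β),
    srcMap (hcompMap α β h) = srcMap α
  tgtMap_hcompMap : ∀ {X Y Z X' Y' Z' : Obj} {M : Hor X Y} {N : Hor Y Z} {M' : Hor X' Y'}
    {N' : Hor Y' Z'} (α : ⟪M⟫ ⟶ ⟪M'⟫) (β : ⟪N⟫ ⟶ ⟪N'⟫) (h : tgtMap α = srcMap β),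
    tgtMap (hcompMap α β h) = tgtMap β
  hcompMap_id : ∀ {X Y Z : Obj} (M : Hor X Y) (N : Hor Y Z) (h : tgtMap (𝟙 ⟪M⟫) = srcMap (𝟙 ⟪N⟫)),
    hcompMap (𝟙 ⟪M⟫) (𝟙 ⟪N⟫) h = 𝟙 ⟪hcomp M N⟫
  hcompMap_comp : ∀ {X Y Z X' Y' Z' X'' Y'' Z'' : Obj} {M : Hor X Y} {N : Hor Y Z}
    {M' : Hor X' Y'} {N' : Hor Y' Z'} {M'' : Hor X'' Y''} {N'' : Hor Y'' Z''}
    (α : ⟪M⟫ ⟶ ⟪M'⟫) (β : ⟪N⟫ ⟶ ⟪N'⟫) (α' : ⟪M'⟫ ⟶ ⟪M''⟫) (β' : ⟪N'⟫ ⟶ ⟪N''⟫)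
    (h : tgtMap α = srcMap β) (h' : tgtMap α' = srcMap β')
    (h'' : tgtMap (α ≫ α') = srcMap (β ≫ β')),
    hcompMap (α ≫ α') (β ≫ β') h'' = hcompMap α β h ≫ hcompMap α' β' h'
  -- associativity constraint
  hassoc : ∀ {W X Y Z : Obj} (M : Hor W X) (N : Hor X Y) (P : Hor Y Z),
    ⟪hcomp (hcomp M N) P⟫ ≅ ⟪hcomp M (hcomp N P)⟫
  srcMap_hassoc : ∀ {W X Y Z : Obj} (M : Hor W X) (N : Hor X Y) (P : Hor Y Z),
    srcMap (hassoc M N P).hom = 𝟙 W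
  tgtMap_hassoc : ∀ {W X Y Z : Obj} (M : Hor W X) (N : Hor X Y) (P : Hor Y Z),
    tgtMap (hassoc M N P).hom = 𝟙 Z
  hassoc_naturality : ∀ {W X Y Z W' X' Y' Z' : Obj} {M : Hor W X} {N : Hor X Y} {P : Hor Y Z}
    {M' : Hor W' X'} {N' : Hor X' Y'} {P' : Hor Y' Z'}
    (α : ⟪M⟫ ⟶ ⟪M'⟫) (β : ⟪N⟫ ⟶ ⟪N'⟫) (γ : ⟪P⟫ ⟶ ⟪P'⟫)
    (h₁ : tgtMap α = srcMap β) (h₂ : tgtMap β = srcMap γ)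
    (h₃ : tgtMap (hcompMap α β h₁) = srcMap γ) (h₄ : tgtMap α = srcMap (hcompMap β γ h₂)),
    hcompMap (hcompMap α β h₁) γ h₃ ≫ (hassoc M' N' P').hom =
      (hassoc M N P).hom ≫ hcompMap α (hcompMap β γ h₂) h₄
  -- unit constraints
  hlunit : ∀ {X Y : Obj} (M : Hor X Y), ⟪hcomp (hid X) M⟫ ≅ ⟪M⟫
  srcMap_hlunit : ∀ {X Y : Obj} (M : Hor X Y), srcMap (hlunit M).hom = 𝟙 X
  tgtMap_hlunit : ∀ {X Y : Obj} (M : Hor X Y), tgtMap (hlunit M).hom = 𝟙 Y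
  hlunit_naturality : ∀ {X Y X' Y' : Obj} {M : Hor X Y} {M' : Hor X' Y'} (α : ⟪M⟫ ⟶ ⟪M'⟫)
    (h : tgtMap (hidMap (srcMap α)) = srcMap α),
    hcompMap (hidMap (srcMap α)) α h ≫ (hlunit M').hom = (hlunit M).hom ≫ α
  hrunit : ∀ {X Y : Obj} (M : Hor X Y), ⟪hcomp M (hid Y)⟫ ≅ ⟪M⟫
  srcMap_hrunit : ∀ {X Y : Obj} (M : Hor X Y), srcMap (hrunit M).hom = 𝟙 X
  tgtMap_hrunit : ∀ {X Y : Obj} (M : Hor X Y), tgtMap (hrunit M).hom = 𝟙 Y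
  hrunit_naturality : ∀ {X Y X' Y' : Obj} {M : Hor X Y} {M' : Hor X' Y'} (α : ⟪M⟫ ⟶ ⟪M'⟫)
    (h : tgtMap α = srcMap (hidMap (tgtMap α))),
    hcompMap α (hidMap (tgtMap α)) h ≫ (hrunit M').hom = (hrunit M).hom ≫ α
  -- coherence
  hpentagon : ∀ {V W X Y Z : Obj} (M : Hor V W) (N : Hor W X) (P : Hor X Y) (Q : Hor Y Z)
    (h₁ : tgtMap (hassoc M N P).hom = srcMap (𝟙 ⟪Q⟫))
    (h₂ : tgtMap (𝟙 ⟪M⟫) = srcMap (hassoc N P Q).hom),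
    hcompMap (hassoc M N P).hom (𝟙 ⟪Q⟫) h₁ ≫ (hassoc M (hcomp N P) Q).hom ≫
        hcompMap (𝟙 ⟪M⟫) (hassoc N P Q).hom h₂ =
      (hassoc (hcomp M N) P Q).hom ≫ (hassoc M N (hcomp P Q)).hom
  htriangle : ∀ {X Y Z : Obj} (M : Hor X Y) (N : Hor Y Z)
    (h₁ : tgtMap (𝟙 ⟪M⟫) = srcMap (hlunit N).hom) (h₂ : tgtMap (hrunit M).hom = srcMap (𝟙 ⟪N⟫)),
    (hassoc M (hid Y) N).hom ≫ hcompMap (𝟙 ⟪M⟫) (hlunit N).hom h₁ =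
      hcompMap (hrunit M).hom (𝟙 ⟪N⟫) h₂

attribute [instance] DoubleCategory.vertCat DoubleCategory.cellCat

/-- A symmetric monoidal double category: the objects and vertical morphisms form a symmetric
monoidal category, so do the horizontal arrows and cells (with the horizontal unit on the unit
object as unit), source and target are strict symmetric monoidal functors, and there are globular
natural isomorphisms `interchange` and `tensorHid` making the tensor product a pseudo double
functor, for which the associator, the unitors and the braiding are transformations of double
categories. -/
structure SymMonDoubleCategory extends DoubleCategory.{u₀, v₀, u₁, v₁} where
  [mon : MonoidalCategory Obj]
  [symm : SymmetricCategory Obj]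
  -- tensor product of horizontal arrows and of cells
  tensorHor : ∀ {X Y X' Y' : Obj}, Hor X Y → Hor X' Y' → Hor (X ⊗ X') (Y ⊗ Y')
  tensorMap : ∀ {X₁ Y₁ X₂ Y₂ X₁' Y₁' X₂' Y₂' : Obj} {M : Hor X₁ Y₁} {N : Hor X₂ Y₂}
    {M' : Hor X₁' Y₁'} {N' : Hor X₂' Y₂'}, (⟪M⟫ ⟶ ⟪M'⟫) → (⟪N⟫ ⟶ ⟪N'⟫) →
    (⟪tensorHor M N⟫ ⟶ ⟪tensorHor M' N'⟫)
  srcMap_tensorMap : ∀ {X₁ Y₁ X₂ Y₂ X₁' Y₁' X₂' Y₂' : Obj} {M : Hor X₁ Y₁} {N : Hor X₂ Y₂}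
    {M' : Hor X₁' Y₁'} {N' : Hor X₂' Y₂'} (α : ⟪M⟫ ⟶ ⟪M'⟫) (β : ⟪N⟫ ⟶ ⟪N'⟫),
    srcMap (tensorMap α β) = srcMap α ⊗ₘ srcMap β
  tgtMap_tensorMap : ∀ {X₁ Y₁ X₂ Y₂ X₁' Y₁' X₂' Y₂' : Obj} {M : Hor X₁ Y₁} {N : Hor X₂ Y₂}
    {M' : Hor X₁' Y₁'} {N' : Hor X₂' Y₂'} (α : ⟪M⟫ ⟶ ⟪M'⟫) (β : ⟪N⟫ ⟶ ⟪N'⟫),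
    tgtMap (tensorMap α β) = tgtMap α ⊗ₘ tgtMap β
  tensorMap_id : ∀ {X Y X' Y' : Obj} (M : Hor X Y) (N : Hor X' Y'),
    tensorMap (𝟙 ⟪M⟫) (𝟙 ⟪N⟫) = 𝟙 ⟪tensorHor M N⟫
  tensorMap_comp : ∀ {X₁ Y₁ X₂ Y₂ X₁' Y₁' X₂' Y₂' X₁'' Y₁'' X₂'' Y₂'' : Obj}
    {M : Hor X₁ Y₁} {N : Hor X₂ Y₂} {M' : Hor X₁' Y₁'} {N' : Hor X₂' Y₂'}
    {M'' : Hor X₁'' Y₁''} {N'' : Hor X₂'' Y₂''}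
    (α : ⟪M⟫ ⟶ ⟪M'⟫) (β : ⟪N⟫ ⟶ ⟪N'⟫) (α' : ⟪M'⟫ ⟶ ⟪M''⟫) (β' : ⟪N'⟫ ⟶ ⟪N''⟫),
    tensorMap (α ≫ α') (β ≫ β') = tensorMap α β ≫ tensorMap α' β'
  -- associator
  tassoc : ∀ {X₁ Y₁ X₂ Y₂ X₃ Y₃ : Obj} (M : Hor X₁ Y₁) (N : Hor X₂ Y₂) (P : Hor X₃ Y₃),
    ⟪tensorHor (tensorHor M N) P⟫ ≅ ⟪tensorHor M (tensorHor N P)⟫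
  srcMap_tassoc : ∀ {X₁ Y₁ X₂ Y₂ X₃ Y₃ : Obj} (M : Hor X₁ Y₁) (N : Hor X₂ Y₂) (P : Hor X₃ Y₃),
    srcMap (tassoc M N P).hom = (α_ X₁ X₂ X₃).hom
  tgtMap_tassoc : ∀ {X₁ Y₁ X₂ Y₂ X₃ Y₃ : Obj} (M : Hor X₁ Y₁) (N : Hor X₂ Y₂) (P : Hor X₃ Y₃),
    tgtMap (tassoc M N P).hom = (α_ Y₁ Y₂ Y₃).hom
  tassoc_naturality : ∀ {X₁ Y₁ X₂ Y₂ X₃ Y₃ X₁' Y₁' X₂' Y₂' X₃' Y₃' : Obj}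
    {M : Hor X₁ Y₁} {N : Hor X₂ Y₂} {P : Hor X₃ Y₃}
    {M' : Hor X₁' Y₁'} {N' : Hor X₂' Y₂'} {P' : Hor X₃' Y₃'}
    (α : ⟪M⟫ ⟶ ⟪M'⟫) (β : ⟪N⟫ ⟶ ⟪N'⟫) (γ : ⟪P⟫ ⟶ ⟪P'⟫),
    tensorMap (tensorMap α β) γ ≫ (tassoc M' N' P').hom =
      (tassoc M N P).hom ≫ tensorMap α (tensorMap β γ)
  -- unitors
  tlunit : ∀ {X Y : Obj} (M : Hor X Y), ⟪tensorHor (hid (𝟙_ Obj)) M⟫ ≅ ⟪M⟫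
  srcMap_tlunit : ∀ {X Y : Obj} (M : Hor X Y), srcMap (tlunit M).hom = (λ_ X).hom
  tgtMap_tlunit : ∀ {X Y : Obj} (M : Hor X Y), tgtMap (tlunit M).hom = (λ_ Y).hom
  tlunit_naturality : ∀ {X Y X' Y' : Obj} {M : Hor X Y} {M' : Hor X' Y'} (α : ⟪M⟫ ⟶ ⟪M'⟫),
    tensorMap (𝟙 ⟪hid (𝟙_ Obj)⟫) α ≫ (tlunit M').hom = (tlunit M).hom ≫ α
  trunit : ∀ {X Y : Obj} (M : Hor X Y), ⟪tensorHor M (hid (𝟙_ Obj))⟫ ≅ ⟪M⟫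
  srcMap_trunit : ∀ {X Y : Obj} (M : Hor X Y), srcMap (trunit M).hom = (ρ_ X).hom
  tgtMap_trunit : ∀ {X Y : Obj} (M : Hor X Y), tgtMap (trunit M).hom = (ρ_ Y).hom
  trunit_naturality : ∀ {X Y X' Y' : Obj} {M : Hor X Y} {M' : Hor X' Y'} (α : ⟪M⟫ ⟶ ⟪M'⟫),
    tensorMap α (𝟙 ⟪hid (𝟙_ Obj)⟫) ≫ (trunit M').hom = (trunit M).hom ≫ α
  -- symmetry
  tbraid : ∀ {X₁ Y₁ X₂ Y₂ : Obj} (M : Hor X₁ Y₁) (N : Hor X₂ Y₂),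
    ⟪tensorHor M N⟫ ≅ ⟪tensorHor N M⟫
  srcMap_tbraid : ∀ {X₁ Y₁ X₂ Y₂ : Obj} (M : Hor X₁ Y₁) (N : Hor X₂ Y₂),
    srcMap (tbraid M N).hom = (β_ X₁ X₂).hom
  tgtMap_tbraid : ∀ {X₁ Y₁ X₂ Y₂ : Obj} (M : Hor X₁ Y₁) (N : Hor X₂ Y₂),
    tgtMap (tbraid M N).hom = (β_ Y₁ Y₂).hom
  tbraid_naturality : ∀ {X₁ Y₁ X₂ Y₂ X₁' Y₁' X₂' Y₂' : Obj} {M : Hor X₁ Y₁} {N : Hor X₂ Y₂}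
    {M' : Hor X₁' Y₁'} {N' : Hor X₂' Y₂'} (α : ⟪M⟫ ⟶ ⟪M'⟫) (β : ⟪N⟫ ⟶ ⟪N'⟫),
    tensorMap α β ≫ (tbraid M' N').hom = (tbraid M N).hom ≫ tensorMap β α
  -- axioms of a symmetric monoidal category for horizontal arrows
  tpentagon : ∀ {X₁ Y₁ X₂ Y₂ X₃ Y₃ X₄ Y₄ : Obj}
    (M : Hor X₁ Y₁) (N : Hor X₂ Y₂) (P : Hor X₃ Y₃) (Q : Hor X₄ Y₄),
    tensorMap (tassoc M N P).hom (𝟙 ⟪Q⟫) ≫ (tassoc M (tensorHor N P) Q).hom ≫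
        tensorMap (𝟙 ⟪M⟫) (tassoc N P Q).hom =
      (tassoc (tensorHor M N) P Q).hom ≫ (tassoc M N (tensorHor P Q)).hom
  ttriangle : ∀ {X₁ Y₁ X₂ Y₂ : Obj} (M : Hor X₁ Y₁) (N : Hor X₂ Y₂),
    (tassoc M (hid (𝟙_ Obj)) N).hom ≫ tensorMap (𝟙 ⟪M⟫) (tlunit N).hom =
      tensorMap (trunit M).hom (𝟙 ⟪N⟫)
  thexagon : ∀ {X₁ Y₁ X₂ Y₂ X₃ Y₃ : Obj} (M : Hor X₁ Y₁) (N : Hor X₂ Y₂) (P : Hor X₃ Y₃),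
    (tassoc M N P).hom ≫ (tbraid M (tensorHor N P)).hom ≫ (tassoc N P M).hom =
      tensorMap (tbraid M N).hom (𝟙 ⟪P⟫) ≫ (tassoc N M P).hom ≫
        tensorMap (𝟙 ⟪N⟫) (tbraid M P).hom
  tsymmetry : ∀ {X₁ Y₁ X₂ Y₂ : Obj} (M : Hor X₁ Y₁) (N : Hor X₂ Y₂),
    (tbraid M N).hom ≫ (tbraid N M).hom = 𝟙 ⟪tensorHor M N⟫
  -- compatibility of the tensor product with horizontal composition
  interchange : ∀ {X Y Z X' Y' Z' : Obj}
    (M₁ : Hor X Y) (N₁ : Hor X' Y') (M₂ : Hor Y Z) (N₂ : Hor Y' Z'),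
    ⟪hcomp (tensorHor M₁ N₁) (tensorHor M₂ N₂)⟫ ≅ ⟪tensorHor (hcomp M₁ M₂) (hcomp N₁ N₂)⟫
  srcMap_interchange : ∀ {X Y Z X' Y' Z' : Obj}
    (M₁ : Hor X Y) (N₁ : Hor X' Y') (M₂ : Hor Y Z) (N₂ : Hor Y' Z'),
    srcMap (interchange M₁ N₁ M₂ N₂).hom = 𝟙 (X ⊗ X')
  tgtMap_interchange : ∀ {X Y Z X' Y' Z' : Obj}
    (M₁ : Hor X Y) (N₁ : Hor X' Y') (M₂ : Hor Y Z) (N₂ : Hor Y' Z'),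
    tgtMap (interchange M₁ N₁ M₂ N₂).hom = 𝟙 (Z ⊗ Z')
  interchange_naturality : ∀ {X Y Z X' Y' Z' A B C A' B' C' : Obj}
    {M₁ : Hor X Y} {N₁ : Hor X' Y'} {M₂ : Hor Y Z} {N₂ : Hor Y' Z'}
    {P₁ : Hor A B} {Q₁ : Hor A' B'} {P₂ : Hor B C} {Q₂ : Hor B' C'}
    (α₁ : ⟪M₁⟫ ⟶ ⟪P₁⟫) (β₁ : ⟪N₁⟫ ⟶ ⟪Q₁⟫) (α₂ : ⟪M₂⟫ ⟶ ⟪P₂⟫) (β₂ : ⟪N₂⟫ ⟶ ⟪Q₂⟫)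
    (h₁ : tgtMap α₁ = srcMap α₂) (h₂ : tgtMap β₁ = srcMap β₂)
    (h₃ : tgtMap (tensorMap α₁ β₁) = srcMap (tensorMap α₂ β₂)),
    hcompMap (tensorMap α₁ β₁) (tensorMap α₂ β₂) h₃ ≫ (interchange P₁ Q₁ P₂ Q₂).hom =
      (interchange M₁ N₁ M₂ N₂).hom ≫ tensorMap (hcompMap α₁ α₂ h₁) (hcompMap β₁ β₂ h₂)
  -- compatibility of the tensor product with horizontal units
  tensorHid : ∀ X Y : Obj, ⟪hid (X ⊗ Y)⟫ ≅ ⟪tensorHor (hid X) (hid Y)⟫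
  srcMap_tensorHid : ∀ X Y : Obj, srcMap (tensorHid X Y).hom = 𝟙 (X ⊗ Y)
  tgtMap_tensorHid : ∀ X Y : Obj, tgtMap (tensorHid X Y).hom = 𝟙 (X ⊗ Y)
  tensorHid_naturality : ∀ {X Y X' Y' : Obj} (f : X ⟶ X') (g : Y ⟶ Y'),
    hidMap (f ⊗ₘ g) ≫ (tensorHid X' Y').hom = (tensorHid X Y).hom ≫ tensorMap (hidMap f) (hidMap g)
  -- the tensor product is a pseudo double functor
  interchange_hassoc : ∀ {W X Y Z W' X' Y' Z' : Obj} (M₁ : Hor W X) (N₁ : Hor W' X')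
    (M₂ : Hor X Y) (N₂ : Hor X' Y') (M₃ : Hor Y Z) (N₃ : Hor Y' Z')
    (h₁ : tgtMap (interchange M₁ N₁ M₂ N₂).hom = srcMap (𝟙 ⟪tensorHor M₃ N₃⟫))
    (h₂ : tgtMap (𝟙 ⟪tensorHor M₁ N₁⟫) = srcMap (interchange M₂ N₂ M₃ N₃).hom),
    hcompMap (interchange M₁ N₁ M₂ N₂).hom (𝟙 ⟪tensorHor M₃ N₃⟫) h₁ ≫
        (interchange (hcomp M₁ M₂) (hcomp N₁ N₂) M₃ N₃).hom ≫
        tensorMap (hassoc M₁ M₂ M₃).hom (hassoc N₁ N₂ N₃).hom =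
      (hassoc (tensorHor M₁ N₁) (tensorHor M₂ N₂) (tensorHor M₃ N₃)).hom ≫
        hcompMap (𝟙 ⟪tensorHor M₁ N₁⟫) (interchange M₂ N₂ M₃ N₃).hom h₂ ≫
        (interchange M₁ N₁ (hcomp M₂ M₃) (hcomp N₂ N₃)).hom
  interchange_hlunit : ∀ {X Y X' Y' : Obj} (M : Hor X Y) (N : Hor X' Y')
    (h : tgtMap (tensorHid X X').hom = srcMap (𝟙 ⟪tensorHor M N⟫)),
    hcompMap (tensorHid X X').hom (𝟙 ⟪tensorHor M N⟫) h ≫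
        (interchange (hid X) (hid X') M N).hom ≫ tensorMap (hlunit M).hom (hlunit N).hom =
      (hlunit (tensorHor M N)).hom
  interchange_hrunit : ∀ {X Y X' Y' : Obj} (M : Hor X Y) (N : Hor X' Y')
    (h : tgtMap (𝟙 ⟪tensorHor M N⟫) = srcMap (tensorHid Y Y').hom),
    hcompMap (𝟙 ⟪tensorHor M N⟫) (tensorHid Y Y').hom h ≫
        (interchange M N (hid Y) (hid Y')).hom ≫ tensorMap (hrunit M).hom (hrunit N).hom =
      (hrunit (tensorHor M N)).hom
  -- the associator is a transformation of double categories
  tassoc_hcomp : ∀ {X₁ Y₁ Z₁ X₂ Y₂ Z₂ X₃ Y₃ Z₃ : Obj} (M₁ : Hor X₁ Y₁) (N₁ : Hor X₂ Y₂)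
    (P₁ : Hor X₃ Y₃) (M₂ : Hor Y₁ Z₁) (N₂ : Hor Y₂ Z₂) (P₂ : Hor Y₃ Z₃)
    (h : tgtMap (tassoc M₁ N₁ P₁).hom = srcMap (tassoc M₂ N₂ P₂).hom),
    hcompMap (tassoc M₁ N₁ P₁).hom (tassoc M₂ N₂ P₂).hom h ≫
        (interchange M₁ (tensorHor N₁ P₁) M₂ (tensorHor N₂ P₂)).hom ≫
        tensorMap (𝟙 ⟪hcomp M₁ M₂⟫) (interchange N₁ P₁ N₂ P₂).hom =
      (interchange (tensorHor M₁ N₁) P₁ (tensorHor M₂ N₂) P₂).hom ≫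
        tensorMap (interchange M₁ N₁ M₂ N₂).hom (𝟙 ⟪hcomp P₁ P₂⟫) ≫
        (tassoc (hcomp M₁ M₂) (hcomp N₁ N₂) (hcomp P₁ P₂)).hom
  tassoc_hid : ∀ X Y Z : Obj,
    hidMap (α_ X Y Z).hom ≫ (tensorHid X (Y ⊗ Z)).hom ≫
        tensorMap (𝟙 ⟪hid X⟫) (tensorHid Y Z).hom =
      (tensorHid (X ⊗ Y) Z).hom ≫ tensorMap (tensorHid X Y).hom (𝟙 ⟪hid Z⟫) ≫
        (tassoc (hid X) (hid Y) (hid Z)).hom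
  -- the unitors are transformations of double categories
  tlunit_hcomp : ∀ {X Y Z : Obj} (M : Hor X Y) (N : Hor Y Z)
    (h : tgtMap (tlunit M).hom = srcMap (tlunit N).hom),
    (interchange (hid (𝟙_ Obj)) M (hid (𝟙_ Obj)) N).hom ≫
        tensorMap (hlunit (hid (𝟙_ Obj))).hom (𝟙 ⟪hcomp M N⟫) ≫ (tlunit (hcomp M N)).hom =
      hcompMap (tlunit M).hom (tlunit N).hom h
  tlunit_hid : ∀ X : Obj, (tensorHid (𝟙_ Obj) X).hom ≫ (tlunit (hid X)).hom = hidMap (λ_ X).hom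
  trunit_hcomp : ∀ {X Y Z : Obj} (M : Hor X Y) (N : Hor Y Z)
    (h : tgtMap (trunit M).hom = srcMap (trunit N).hom),
    (interchange M (hid (𝟙_ Obj)) N (hid (𝟙_ Obj))).hom ≫
        tensorMap (𝟙 ⟪hcomp M N⟫) (hlunit (hid (𝟙_ Obj))).hom ≫ (trunit (hcomp M N)).hom =
      hcompMap (trunit M).hom (trunit N).hom h
  trunit_hid : ∀ X : Obj, (tensorHid X (𝟙_ Obj)).hom ≫ (trunit (hid X)).hom = hidMap (ρ_ X).hom
  -- the braiding is a transformation of double categories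
  tbraid_hcomp : ∀ {X Y Z X' Y' Z' : Obj}
    (M₁ : Hor X Y) (N₁ : Hor X' Y') (M₂ : Hor Y Z) (N₂ : Hor Y' Z')
    (h : tgtMap (tbraid M₁ N₁).hom = srcMap (tbraid M₂ N₂).hom),
    (interchange M₁ N₁ M₂ N₂).hom ≫ (tbraid (hcomp M₁ M₂) (hcomp N₁ N₂)).hom =
      hcompMap (tbraid M₁ N₁).hom (tbraid M₂ N₂).hom h ≫ (interchange N₁ M₁ N₂ M₂).hom
  tbraid_hid : ∀ X Y : Obj,
    (tensorHid X Y).hom ≫ (tbraid (hid X) (hid Y)).hom = hidMap (β_ X Y).hom ≫ (tensorHid Y X).hom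

attribute [instance] SymMonDoubleCategory.mon SymMonDoubleCategory.symm

/-- The underlying data of a double functor: a functor on objects and vertical morphisms, and
compatible maps on horizontal arrows and on cells. -/
structure DoubleFunctorData (D : DoubleCategory.{u₀, v₀, u₁, v₁})
    (E : DoubleCategory.{u₂, v₂, u₃, v₃}) where
  vert : D.Obj ⥤ E.Obj
  hor : ∀ {X Y : D.Obj}, D.Hor X Y → E.Hor (vert.obj X) (vert.obj Y)
  cell : ∀ {X Y X' Y' : D.Obj} {M : D.Hor X Y} {M' : D.Hor X' Y'},
    (⟪M⟫ ⟶ ⟪M'⟫) → (⟪hor M⟫ ⟶ ⟪hor M'⟫)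

/-- A (pseudo) double functor: it respects sources and targets strictly, is functorial on cells, and
preserves horizontal composition and horizontal units up to coherent natural globular
isomorphisms. -/
structure DoubleFunctor (D : DoubleCategory.{u₀, v₀, u₁, v₁})
    (E : DoubleCategory.{u₂, v₂, u₃, v₃}) extends DoubleFunctorData D E where
  srcMap_cell : ∀ {X Y X' Y' : D.Obj} {M : D.Hor X Y} {M' : D.Hor X' Y'} (α : ⟪M⟫ ⟶ ⟪M'⟫),
    E.srcMap (cell α) = vert.map (D.srcMap α)
  tgtMap_cell : ∀ {X Y X' Y' : D.Obj} {M : D.Hor X Y} {M' : D.Hor X' Y'} (α : ⟪M⟫ ⟶ ⟪M'⟫),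
    E.tgtMap (cell α) = vert.map (D.tgtMap α)
  cell_id : ∀ {X Y : D.Obj} (M : D.Hor X Y), cell (𝟙 ⟪M⟫) = 𝟙 ⟪hor M⟫
  cell_comp : ∀ {X Y X' Y' X'' Y'' : D.Obj}
    {M : D.Hor X Y} {M' : D.Hor X' Y'} {M'' : D.Hor X'' Y''}
    (α : ⟪M⟫ ⟶ ⟪M'⟫) (β : ⟪M'⟫ ⟶ ⟪M''⟫), cell (α ≫ β) = cell α ≫ cell β
  -- comparison for horizontal composition
  compIso : ∀ {X Y Z : D.Obj} (M : D.Hor X Y) (N : D.Hor Y Z),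
    ⟪E.hcomp (hor M) (hor N)⟫ ≅ ⟪hor (D.hcomp M N)⟫
  srcMap_compIso : ∀ {X Y Z : D.Obj} (M : D.Hor X Y) (N : D.Hor Y Z),
    E.srcMap (compIso M N).hom = 𝟙 (vert.obj X)
  tgtMap_compIso : ∀ {X Y Z : D.Obj} (M : D.Hor X Y) (N : D.Hor Y Z),
    E.tgtMap (compIso M N).hom = 𝟙 (vert.obj Z)
  compIso_naturality : ∀ {X Y Z X' Y' Z' : D.Obj} {M : D.Hor X Y} {N : D.Hor Y Z}
    {M' : D.Hor X' Y'} {N' : D.Hor Y' Z'} (α : ⟪M⟫ ⟶ ⟪M'⟫) (β : ⟪N⟫ ⟶ ⟪N'⟫)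
    (h : D.tgtMap α = D.srcMap β) (h' : E.tgtMap (cell α) = E.srcMap (cell β)),
    E.hcompMap (cell α) (cell β) h' ≫ (compIso M' N').hom =
      (compIso M N).hom ≫ cell (D.hcompMap α β h)
  -- comparison for horizontal units
  unitIso : ∀ X : D.Obj, ⟪E.hid (vert.obj X)⟫ ≅ ⟪hor (D.hid X)⟫
  srcMap_unitIso : ∀ X : D.Obj, E.srcMap (unitIso X).hom = 𝟙 (vert.obj X)
  tgtMap_unitIso : ∀ X : D.Obj, E.tgtMap (unitIso X).hom = 𝟙 (vert.obj X)
  unitIso_naturality : ∀ {X Y : D.Obj} (f : X ⟶ Y),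
    E.hidMap (vert.map f) ≫ (unitIso Y).hom = (unitIso X).hom ≫ cell (D.hidMap f)
  -- coherence
  compIso_hassoc : ∀ {W X Y Z : D.Obj} (M : D.Hor W X) (N : D.Hor X Y) (P : D.Hor Y Z)
    (h₁ : E.tgtMap (compIso M N).hom = E.srcMap (𝟙 ⟪hor P⟫))
    (h₂ : E.tgtMap (𝟙 ⟪hor M⟫) = E.srcMap (compIso N P).hom),
    E.hcompMap (compIso M N).hom (𝟙 ⟪hor P⟫) h₁ ≫ (compIso (D.hcomp M N) P).hom ≫
        cell (D.hassoc M N P).hom =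
      (E.hassoc (hor M) (hor N) (hor P)).hom ≫
        E.hcompMap (𝟙 ⟪hor M⟫) (compIso N P).hom h₂ ≫ (compIso M (D.hcomp N P)).hom
  compIso_hlunit : ∀ {X Y : D.Obj} (M : D.Hor X Y)
    (h : E.tgtMap (unitIso X).hom = E.srcMap (𝟙 ⟪hor M⟫)),
    E.hcompMap (unitIso X).hom (𝟙 ⟪hor M⟫) h ≫ (compIso (D.hid X) M).hom ≫ cell (D.hlunit M).hom =
      (E.hlunit (hor M)).hom
  compIso_hrunit : ∀ {X Y : D.Obj} (M : D.Hor X Y)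
    (h : E.tgtMap (𝟙 ⟪hor M⟫) = E.srcMap (unitIso Y).hom),
    E.hcompMap (𝟙 ⟪hor M⟫) (unitIso Y).hom h ≫ (compIso M (D.hid Y)).hom ≫ cell (D.hrunit M).hom =
      (E.hrunit (hor M)).hom

open Functor.LaxMonoidal in
/-- A (strong) symmetric monoidal double functor: a double functor which is a symmetric monoidal
functor on vertical morphisms and on cells, compatibly with source and target, and such that the
monoidal comparisons `tensorIso` and `tensorUnitIso` are transformations of double categories. -/
structure SymMonDoubleFunctor (D : SymMonDoubleCategory.{u₀, v₀, u₁, v₁})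
    (E : SymMonDoubleCategory.{u₂, v₂, u₃, v₃}) extends
    DoubleFunctor D.toDoubleCategory E.toDoubleCategory where
  [braided : vert.Braided]
  tensorIso : ∀ {X Y X' Y' : D.Obj} (M : D.Hor X Y) (N : D.Hor X' Y'),
    ⟪E.tensorHor (hor M) (hor N)⟫ ≅ ⟪hor (D.tensorHor M N)⟫
  srcMap_tensorIso : ∀ {X Y X' Y' : D.Obj} (M : D.Hor X Y) (N : D.Hor X' Y'),
    E.srcMap (tensorIso M N).hom = μ vert X X'
  tgtMap_tensorIso : ∀ {X Y X' Y' : D.Obj} (M : D.Hor X Y) (N : D.Hor X' Y'),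
    E.tgtMap (tensorIso M N).hom = μ vert Y Y'
  tensorIso_naturality : ∀ {X₁ Y₁ X₂ Y₂ X₁' Y₁' X₂' Y₂' : D.Obj} {M : D.Hor X₁ Y₁} {N : D.Hor X₂ Y₂}
    {M' : D.Hor X₁' Y₁'} {N' : D.Hor X₂' Y₂'} (α : ⟪M⟫ ⟶ ⟪M'⟫) (β : ⟪N⟫ ⟶ ⟪N'⟫),
    E.tensorMap (cell α) (cell β) ≫ (tensorIso M' N').hom =
      (tensorIso M N).hom ≫ cell (D.tensorMap α β)
  tensorUnitIso : ⟪E.hid (𝟙_ E.Obj)⟫ ≅ ⟪hor (D.hid (𝟙_ D.Obj))⟫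
  srcMap_tensorUnitIso : E.srcMap tensorUnitIso.hom = ε vert
  tgtMap_tensorUnitIso : E.tgtMap tensorUnitIso.hom = ε vert
  -- axioms of a symmetric monoidal functor for horizontal arrows
  tensorIso_tassoc : ∀ {X₁ Y₁ X₂ Y₂ X₃ Y₃ : D.Obj}
    (M : D.Hor X₁ Y₁) (N : D.Hor X₂ Y₂) (P : D.Hor X₃ Y₃),
    E.tensorMap (tensorIso M N).hom (𝟙 ⟪hor P⟫) ≫ (tensorIso (D.tensorHor M N) P).hom ≫
        cell (D.tassoc M N P).hom =
      (E.tassoc (hor M) (hor N) (hor P)).hom ≫ E.tensorMap (𝟙 ⟪hor M⟫) (tensorIso N P).hom ≫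
        (tensorIso M (D.tensorHor N P)).hom
  tensorIso_tlunit : ∀ {X Y : D.Obj} (M : D.Hor X Y),
    E.tensorMap tensorUnitIso.hom (𝟙 ⟪hor M⟫) ≫ (tensorIso (D.hid (𝟙_ D.Obj)) M).hom ≫
        cell (D.tlunit M).hom = (E.tlunit (hor M)).hom
  tensorIso_trunit : ∀ {X Y : D.Obj} (M : D.Hor X Y),
    E.tensorMap (𝟙 ⟪hor M⟫) tensorUnitIso.hom ≫ (tensorIso M (D.hid (𝟙_ D.Obj))).hom ≫
        cell (D.trunit M).hom = (E.trunit (hor M)).hom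
  tensorIso_tbraid : ∀ {X Y X' Y' : D.Obj} (M : D.Hor X Y) (N : D.Hor X' Y'),
    (tensorIso M N).hom ≫ cell (D.tbraid M N).hom =
      (E.tbraid (hor M) (hor N)).hom ≫ (tensorIso N M).hom
  -- the monoidal comparisons are transformations of double categories
  tensorIso_hcomp : ∀ {X Y Z X' Y' Z' : D.Obj}
    (M₁ : D.Hor X Y) (N₁ : D.Hor X' Y') (M₂ : D.Hor Y Z) (N₂ : D.Hor Y' Z')
    (h : E.tgtMap (tensorIso M₁ N₁).hom = E.srcMap (tensorIso M₂ N₂).hom),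
    (E.interchange (hor M₁) (hor N₁) (hor M₂) (hor N₂)).hom ≫
        E.tensorMap (compIso M₁ M₂).hom (compIso N₁ N₂).hom ≫
        (tensorIso (D.hcomp M₁ M₂) (D.hcomp N₁ N₂)).hom =
      E.hcompMap (tensorIso M₁ N₁).hom (tensorIso M₂ N₂).hom h ≫
        (compIso (D.tensorHor M₁ N₁) (D.tensorHor M₂ N₂)).hom ≫
        cell (D.interchange M₁ N₁ M₂ N₂).hom
  tensorIso_hid : ∀ X Y : D.Obj,
    (E.tensorHid (vert.obj X) (vert.obj Y)).hom ≫ E.tensorMap (unitIso X).hom (unitIso Y).hom ≫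
        (tensorIso (D.hid X) (D.hid Y)).hom =
      E.hidMap (μ vert X Y) ≫ (unitIso (X ⊗ Y)).hom ≫ cell (D.tensorHid X Y).hom
  tensorUnitIso_hid : tensorUnitIso.hom = E.hidMap (ε vert) ≫ (unitIso (𝟙_ D.Obj)).hom

/-! ### Sets under disjoint union -/

namespace SetSum

/-- The disjoint union of two functions. -/
abbrev map {X Y X' Y' : Type u} (f : X ⟶ X') (g : Y ⟶ Y') : (X ⊕ Y : Type u) ⟶ (X' ⊕ Y' : Type u) :=
  ↾(Sum.map f g)

abbrev inl (X Y : Type u) : X ⟶ (X ⊕ Y : Type u) := ↾Sum.inl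

abbrev inr (X Y : Type u) : Y ⟶ (X ⊕ Y : Type u) := ↾Sum.inr

/-- The isomorphism of sets given by a bijection. -/
abbrev isoOfEquiv {X Y : Type u} (e : X ≃ Y) : X ≅ Y where
  hom := ↾e
  inv := ↾e.symm
  hom_inv_id := by ext x; exact e.symm_apply_apply x
  inv_hom_id := by ext x; exact e.apply_symm_apply x

/-- The category of sets as a monoidal category under disjoint union. -/
@[reducible] def monoidal : MonoidalCategory (Type u) :=
  letI : MonoidalCategoryStruct (Type u) :=
    { tensorObj := fun X Y => X ⊕ Y
      whiskerLeft := fun X _ _ f => map (𝟙 X) f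
      whiskerRight := fun f Y => map f (𝟙 Y)
      tensorHom := fun f g => map f g
      tensorUnit := PEmpty
      associator := fun X Y Z => isoOfEquiv (Equiv.sumAssoc X Y Z)
      leftUnitor := fun X => isoOfEquiv (Equiv.emptySum PEmpty X)
      rightUnitor := fun X => isoOfEquiv (Equiv.sumEmpty X PEmpty) }
  MonoidalCategory.ofTensorHom
    (id_tensorHom_id := fun _ _ => by ext x; rcases x with x | x <;> rfl)
    (id_tensorHom := fun _ _ _ _ => rfl)
    (tensorHom_id := fun _ _ => rfl)
    (tensorHom_comp_tensorHom := fun _ _ _ _ => by ext x; rcases x with x | x <;> rfl)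
    (associator_naturality := fun _ _ _ => by ext x; rcases x with (x | x) | x <;> rfl)
    (leftUnitor_naturality := fun _ => by ext x; rcases x with x | x; · exact x.elim
                                          · rfl)
    (rightUnitor_naturality := fun _ => by ext x; rcases x with x | x; · rfl
                                           · exact x.elim)
    (pentagon := fun _ _ _ _ => by ext x; rcases x with ((x | x) | x) | x <;> rfl)
    (triangle := fun _ _ => by
      ext x; rcases x with (x | x) | x
      · rfl
      · exact x.elim
      · rfl)

/-- Disjoint union of sets is symmetric. -/
@[reducible] def symmetric : @SymmetricCategory (Type u) _ monoidal :=
  letI : MonoidalCategory (Type u) := monoidal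
  { braiding := fun X Y => isoOfEquiv (Equiv.sumComm X Y)
    braiding_naturality_right := fun _ _ _ _ => by ext x; rcases x with x | x <;> rfl
    braiding_naturality_left := fun _ _ => by ext x; rcases x with x | x <;> rfl
    hexagon_forward := fun _ _ _ => by ext x; rcases x with (x | x) | x <;> rfl
    hexagon_reverse := fun _ _ _ => by ext x; rcases x with x | x | x <;> rfl
    symmetry := fun _ _ => by ext x; rcases x with x | x <;> rfl }

end SetSum

/-! ### Structured cospans -/

section Colimits

variable {C : Type w} [Category.{v} C]

/-- A pushout of a span, with its universal property. -/
structure PushoutOf {K G H : C} (f : K ⟶ G) (g : K ⟶ H) where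
  pt : C
  inl : G ⟶ pt
  inr : H ⟶ pt
  condition : f ≫ inl = g ≫ inr
  desc : ∀ {Z : C} (h : G ⟶ Z) (k : H ⟶ Z), f ≫ h = g ≫ k → (pt ⟶ Z)
  inl_desc : ∀ {Z : C} (h : G ⟶ Z) (k : H ⟶ Z) (e : f ≫ h = g ≫ k), inl ≫ desc h k e = h
  inr_desc : ∀ {Z : C} (h : G ⟶ Z) (k : H ⟶ Z) (e : f ≫ h = g ≫ k), inr ≫ desc h k e = k
  hom_ext : ∀ {Z : C} {a b : pt ⟶ Z}, inl ≫ a = inl ≫ b → inr ≫ a = inr ≫ b → a = b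

/-- A coproduct of two objects, with its universal property. -/
structure CoproductOf (G H : C) where
  pt : C
  inl : G ⟶ pt
  inr : H ⟶ pt
  desc : ∀ {Z : C}, (G ⟶ Z) → (H ⟶ Z) → (pt ⟶ Z)
  inl_desc : ∀ {Z : C} (h : G ⟶ Z) (k : H ⟶ Z), inl ≫ desc h k = h
  inr_desc : ∀ {Z : C} (h : G ⟶ Z) (k : H ⟶ Z), inr ≫ desc h k = k
  hom_ext : ∀ {Z : C} {a b : pt ⟶ Z}, inl ≫ a = inl ≫ b → inr ≫ a = inr ≫ b → a = b

/-- Chosen pushouts and binary coproducts in `C`, together with the fact that `L` preserves finite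
coproducts, i.e. sends disjoint unions to coproducts and the empty set to an initial object. -/
structure Gluing (L : Type u ⥤ C) where
  push : ∀ {K G H : C} (f : K ⟶ G) (g : K ⟶ H), PushoutOf f g
  cop : ∀ G H : C, CoproductOf G H
  sumDesc : ∀ {X Y : Type u} {Z : C}, (L.obj X ⟶ Z) → (L.obj Y ⟶ Z) → (L.obj (X ⊕ Y) ⟶ Z)
  inl_sumDesc : ∀ {X Y : Type u} {Z : C} (f : L.obj X ⟶ Z) (g : L.obj Y ⟶ Z),
    L.map (SetSum.inl X Y) ≫ sumDesc f g = f
  inr_sumDesc : ∀ {X Y : Type u} {Z : C} (f : L.obj X ⟶ Z) (g : L.obj Y ⟶ Z),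
    L.map (SetSum.inr X Y) ≫ sumDesc f g = g
  sum_hom_ext : ∀ {X Y : Type u} {Z : C} {a b : L.obj (X ⊕ Y) ⟶ Z},
    L.map (SetSum.inl X Y) ≫ a = L.map (SetSum.inl X Y) ≫ b →
    L.map (SetSum.inr X Y) ≫ a = L.map (SetSum.inr X Y) ≫ b → a = b
  emptyDesc : ∀ Z : C, L.obj PEmpty ⟶ Z
  empty_hom_ext : ∀ {Z : C} (a b : L.obj PEmpty ⟶ Z), a = b

attribute [simp] PushoutOf.inl_desc PushoutOf.inr_desc CoproductOf.inl_desc CoproductOf.inr_desc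
  Gluing.inl_sumDesc Gluing.inr_sumDesc

section
variable {K G H Z Z' : C} {f : K ⟶ G} {g : K ⟶ H}

@[simp] theorem PushoutOf.inl_desc_assoc (P : PushoutOf f g) (h : G ⟶ Z) (k : H ⟶ Z)
    (e : f ≫ h = g ≫ k) (t : Z ⟶ Z') : P.inl ≫ P.desc h k e ≫ t = h ≫ t := by
  rw [← Category.assoc, P.inl_desc]

@[simp] theorem PushoutOf.inr_desc_assoc (P : PushoutOf f g) (h : G ⟶ Z) (k : H ⟶ Z)
    (e : f ≫ h = g ≫ k) (t : Z ⟶ Z') : P.inr ≫ P.desc h k e ≫ t = k ≫ t := by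
  rw [← Category.assoc, P.inr_desc]

theorem PushoutOf.condition_assoc (P : PushoutOf f g) (t : P.pt ⟶ Z) :
    f ≫ P.inl ≫ t = g ≫ P.inr ≫ t := by
  rw [← Category.assoc, P.condition, Category.assoc]

@[simp] theorem CoproductOf.inl_desc_assoc (P : CoproductOf G H) (h : G ⟶ Z) (k : H ⟶ Z)
    (t : Z ⟶ Z') : P.inl ≫ P.desc h k ≫ t = h ≫ t := by
  rw [← Category.assoc, P.inl_desc]

@[simp] theorem CoproductOf.inr_desc_assoc (P : CoproductOf G H) (h : G ⟶ Z) (k : H ⟶ Z)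
    (t : Z ⟶ Z') : P.inr ≫ P.desc h k ≫ t = k ≫ t := by
  rw [← Category.assoc, P.inr_desc]

variable {L : Type u ⥤ C} (G : Gluing L) {X Y X' Y' : Type u}

@[simp] theorem Gluing.inl_sumDesc_assoc (f : L.obj X ⟶ Z) (g : L.obj Y ⟶ Z) (t : Z ⟶ Z') :
    L.map (SetSum.inl X Y) ≫ G.sumDesc f g ≫ t = f ≫ t := by
  rw [← Category.assoc, G.inl_sumDesc]

@[simp] theorem Gluing.inr_sumDesc_assoc (f : L.obj X ⟶ Z) (g : L.obj Y ⟶ Z) (t : Z ⟶ Z') :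
    L.map (SetSum.inr X Y) ≫ G.sumDesc f g ≫ t = g ≫ t := by
  rw [← Category.assoc, G.inr_sumDesc]

theorem Gluing.map_sumDesc (f : L.obj X' ⟶ Z) (g : L.obj Y' ⟶ Z) (a : X ⟶ X') (b : Y ⟶ Y') :
    L.map (SetSum.map a b) ≫ G.sumDesc f g = G.sumDesc (L.map a ≫ f) (L.map b ≫ g) := by
  apply G.sum_hom_ext
  · rw [G.inl_sumDesc, ← Category.assoc, ← L.map_comp,
      show SetSum.inl X Y ≫ SetSum.map a b = a ≫ SetSum.inl X' Y' from rfl, L.map_comp,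
      Category.assoc, G.inl_sumDesc]
  · rw [G.inr_sumDesc, ← Category.assoc, ← L.map_comp,
      show SetSum.inr X Y ≫ SetSum.map a b = b ≫ SetSum.inr X' Y' from rfl, L.map_comp,
      Category.assoc, G.inr_sumDesc]

theorem Gluing.sumDesc_comp (f : L.obj X ⟶ Z) (g : L.obj Y ⟶ Z) (t : Z ⟶ Z') :
    G.sumDesc f g ≫ t = G.sumDesc (f ≫ t) (g ≫ t) := by
  apply G.sum_hom_ext <;> simp

end

end Colimits

/-- A structured cospan `L X ⟶ apex ⟵ L Y`. -/
structure OpenHor {C : Type w} [Category.{v} C] (L : Type u ⥤ C) (X Y : Type u) where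
  apex : C
  inp : L.obj X ⟶ apex
  out : L.obj Y ⟶ apex

/-- A commutative rectangle between structured cospans. -/
@[ext] structure OpenCell {C : Type w} [Category.{v} C] {L : Type u ⥤ C}
    (M N : HorArrow (OpenHor L)) where
  left : M.src ⟶ N.src
  right : M.tgt ⟶ N.tgt
  mid : M.arr.apex ⟶ N.arr.apex
  inp_comm : L.map left ≫ N.arr.inp = M.arr.inp ≫ mid
  out_comm : L.map right ≫ N.arr.out = M.arr.out ≫ mid

namespace OpenCell

variable {C : Type w} [Category.{v} C] {L : Type u ⥤ C}

/-- Vertical composition of rectangles is componentwise. -/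
instance category : Category (HorArrow (OpenHor L)) where
  Hom M N := OpenCell M N
  id M :=
    { left := 𝟙 _, right := 𝟙 _, mid := 𝟙 _
      inp_comm := by simp
      out_comm := by simp }
  comp α β :=
    { left := α.left ≫ β.left, right := α.right ≫ β.right, mid := α.mid ≫ β.mid
      inp_comm := by rw [L.map_comp, Category.assoc, β.inp_comm, ← Category.assoc, α.inp_comm,
        Category.assoc]
      out_comm := by rw [L.map_comp, Category.assoc, β.out_comm, ← Category.assoc, α.out_comm,
        Category.assoc] }
  id_comp α := by apply OpenCell.ext <;> apply Category.id_comp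
  comp_id α := by apply OpenCell.ext <;> apply Category.comp_id
  assoc α β γ := by apply OpenCell.ext <;> apply Category.assoc

variable {M N P : HorArrow (OpenHor L)}

theorem hom_ext {α β : M ⟶ N} (h₁ : α.left = β.left) (h₂ : α.right = β.right)
    (h₃ : α.mid = β.mid) : α = β := OpenCell.ext h₁ h₂ h₃

@[simp] theorem id_left : left (𝟙 M) = 𝟙 M.src := rfl
@[simp] theorem id_right : right (𝟙 M) = 𝟙 M.tgt := rfl
@[simp] theorem id_mid : mid (𝟙 M) = 𝟙 M.arr.apex := rfl
@[simp] theorem comp_left (α : M ⟶ N) (β : N ⟶ P) : left (α ≫ β) = left α ≫ left β := rfl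
@[simp] theorem comp_right (α : M ⟶ N) (β : N ⟶ P) : right (α ≫ β) = right α ≫ right β := rfl
@[simp] theorem comp_mid (α : M ⟶ N) (β : N ⟶ P) : mid (α ≫ β) = mid α ≫ mid β := rfl

/-- An isomorphism of structured cospans from isomorphisms of the feet and of the apex. -/
def isoMk (l : M.src ≅ N.src) (r : M.tgt ≅ N.tgt) (a : M.arr.apex ≅ N.arr.apex)
    (hl : L.map l.hom ≫ N.arr.inp = M.arr.inp ≫ a.hom)
    (hr : L.map r.hom ≫ N.arr.out = M.arr.out ≫ a.hom) : M ≅ N where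
  hom := { left := l.hom, right := r.hom, mid := a.hom, inp_comm := hl, out_comm := hr }
  inv :=
    { left := l.inv, right := r.inv, mid := a.inv
      inp_comm := by
        rw [← cancel_mono a.hom, Category.assoc, ← hl, ← Category.assoc, ← L.map_comp]; simp
      out_comm := by
        rw [← cancel_mono a.hom, Category.assoc, ← hr, ← Category.assoc, ← L.map_comp]; simp }
  hom_inv_id := by apply hom_ext <;> simp
  inv_hom_id := by apply hom_ext <;> simp

end OpenCell

namespace Gluing

variable {C : Type w} [Category.{v} C] {L : Type u ⥤ C} (G : Gluing L)

/-! Functoriality of the chosen pushouts and coproducts, and their canonical isomorphisms. -/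

/-- The map induced by a map of spans. -/
abbrev pushMap {K A B K' A' B' : C} {f : K ⟶ A} {g : K ⟶ B} {f' : K' ⟶ A'} {g' : K' ⟶ B'}
    (k : K ⟶ K') (a : A ⟶ A') (b : B ⟶ B') (hf : k ≫ f' = f ≫ a) (hg : k ≫ g' = g ≫ b) :
    (G.push f g).pt ⟶ (G.push f' g').pt :=
  (G.push f g).desc (a ≫ (G.push f' g').inl) (b ≫ (G.push f' g').inr) (by
    rw [← Category.assoc, ← hf, ← Category.assoc, ← hg, Category.assoc, Category.assoc,
      (G.push f' g').condition])

/-- The coproduct of two maps. -/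
abbrev copMap {A B A' B' : C} (a : A ⟶ A') (b : B ⟶ B') : (G.cop A B).pt ⟶ (G.cop A' B').pt :=
  (G.cop A B).desc (a ≫ (G.cop A' B').inl) (b ≫ (G.cop A' B').inr)

/-- `(A +_K B) +_J D ≅ A +_K (B +_J D)`. -/
def pushAssoc {K J A B D : C} (f : K ⟶ A) (g : K ⟶ B) (h : J ⟶ B) (k : J ⟶ D) :
    (G.push (h ≫ (G.push f g).inr) k).pt ≅ (G.push f (g ≫ (G.push h k).inl)).pt where
  hom := (G.push _ _).desc
    ((G.push f g).desc (G.push _ _).inl ((G.push h k).inl ≫ (G.push _ _).inr)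
      (by rw [(G.push _ _).condition, Category.assoc]))
    ((G.push h k).inr ≫ (G.push _ _).inr)
    (by rw [Category.assoc, PushoutOf.inr_desc, PushoutOf.condition_assoc])
  inv := (G.push _ _).desc
    ((G.push f g).inl ≫ (G.push _ _).inl)
    ((G.push h k).desc ((G.push f g).inr ≫ (G.push _ _).inl) (G.push _ _).inr
      (by rw [← (G.push _ _).condition, Category.assoc]))
    (by rw [Category.assoc, PushoutOf.inl_desc, PushoutOf.condition_assoc])
  hom_inv_id := by
    refine PushoutOf.hom_ext _ (PushoutOf.hom_ext _ ?_ ?_) ?_ <;> simp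
  inv_hom_id := by
    refine PushoutOf.hom_ext _ ?_ (PushoutOf.hom_ext _ ?_ ?_) <;> simp

/-- `K +_K A ≅ A`. -/
def pushLeftUnit {K A : C} (f : K ⟶ A) : (G.push (𝟙 K) f).pt ≅ A where
  hom := (G.push _ _).desc f (𝟙 A) (by simp)
  inv := (G.push _ _).inr
  hom_inv_id := by
    refine PushoutOf.hom_ext _ ?_ ?_
    · simp [← (G.push (𝟙 K) f).condition]
    · simp
  inv_hom_id := by simp

/-- `A +_K K ≅ A`. -/
def pushRightUnit {K A : C} (f : K ⟶ A) : (G.push f (𝟙 K)).pt ≅ A where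
  hom := (G.push _ _).desc (𝟙 A) f (by simp)
  inv := (G.push _ _).inl
  hom_inv_id := by
    refine PushoutOf.hom_ext _ ?_ ?_
    · simp
    · simp [(G.push f (𝟙 K)).condition]
  inv_hom_id := by simp

/-- `(A ⊔ B) ⊔ D ≅ A ⊔ (B ⊔ D)`. -/
def copAssoc (A B D : C) : (G.cop (G.cop A B).pt D).pt ≅ (G.cop A (G.cop B D).pt).pt where
  hom := (G.cop _ _).desc
    ((G.cop A B).desc (G.cop _ _).inl ((G.cop B D).inl ≫ (G.cop _ _).inr))
    ((G.cop B D).inr ≫ (G.cop _ _).inr)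
  inv := (G.cop _ _).desc
    ((G.cop A B).inl ≫ (G.cop _ _).inl)
    ((G.cop B D).desc ((G.cop A B).inr ≫ (G.cop _ _).inl) (G.cop _ _).inr)
  hom_inv_id := by
    refine CoproductOf.hom_ext _ (CoproductOf.hom_ext _ ?_ ?_) ?_ <;> simp
  inv_hom_id := by
    refine CoproductOf.hom_ext _ ?_ (CoproductOf.hom_ext _ ?_ ?_) <;> simp

/-- `L ∅ ⊔ A ≅ A`. -/
def copLeftUnit (A : C) : (G.cop (L.obj PEmpty) A).pt ≅ A where
  hom := (G.cop _ _).desc (G.emptyDesc A) (𝟙 A)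
  inv := (G.cop _ _).inr
  hom_inv_id := by
    refine CoproductOf.hom_ext _ (G.empty_hom_ext _ _) ?_
    simp
  inv_hom_id := by simp

/-- `A ⊔ L ∅ ≅ A`. -/
def copRightUnit (A : C) : (G.cop A (L.obj PEmpty)).pt ≅ A where
  hom := (G.cop _ _).desc (𝟙 A) (G.emptyDesc A)
  inv := (G.cop _ _).inl
  hom_inv_id := by
    refine CoproductOf.hom_ext _ ?_ (G.empty_hom_ext _ _)
    simp
  inv_hom_id := by simp

/-- `A ⊔ B ≅ B ⊔ A`. -/
def copComm (A B : C) : (G.cop A B).pt ≅ (G.cop B A).pt where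
  hom := (G.cop _ _).desc (G.cop _ _).inr (G.cop _ _).inl
  inv := (G.cop _ _).desc (G.cop _ _).inr (G.cop _ _).inl
  hom_inv_id := by refine CoproductOf.hom_ext _ ?_ ?_ <;> simp
  inv_hom_id := by refine CoproductOf.hom_ext _ ?_ ?_ <;> simp

/-- The structure map `L (X ⊔ Y) ⟶ A ⊔ B` of the coproduct of two objects over `L X`, `L Y`. -/
abbrev leg {X Y : Type u} {A B : C} (a : L.obj X ⟶ A) (b : L.obj Y ⟶ B) :
    L.obj (X ⊕ Y) ⟶ (G.cop A B).pt :=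
  G.sumDesc (a ≫ (G.cop A B).inl) (b ≫ (G.cop A B).inr)

/-- `(A ⊔ A') +_{L (Y ⊔ Y')} (B ⊔ B') ≅ (A +_{L Y} B) ⊔ (A' +_{L Y'} B')`. -/
def pushCop {Y Y' : Type u} {A A' B B' : C} (a : L.obj Y ⟶ A) (a' : L.obj Y' ⟶ A')
    (b : L.obj Y ⟶ B) (b' : L.obj Y' ⟶ B') :
    (G.push (G.leg a a') (G.leg b b')).pt ≅ (G.cop (G.push a b).pt (G.push a' b').pt).pt where
  hom := (G.push _ _).desc
    (G.copMap (G.push a b).inl (G.push a' b').inl) (G.copMap (G.push a b).inr (G.push a' b').inr)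
    (by apply G.sum_hom_ext <;> simp [PushoutOf.condition_assoc])
  inv := (G.cop _ _).desc
    ((G.push a b).desc ((G.cop A A').inl ≫ (G.push _ _).inl) ((G.cop B B').inl ≫ (G.push _ _).inr)
      (by
        have := congrArg (fun t => L.map (SetSum.inl Y Y') ≫ t)
          (G.push (G.leg a a') (G.leg b b')).condition
        simpa using this))
    ((G.push a' b').desc ((G.cop A A').inr ≫ (G.push _ _).inl)
      ((G.cop B B').inr ≫ (G.push _ _).inr)
      (by
        have := congrArg (fun t => L.map (SetSum.inr Y Y') ≫ t)
          (G.push (G.leg a a') (G.leg b b')).condition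
        simpa using this))
  hom_inv_id := by
    refine PushoutOf.hom_ext _ (CoproductOf.hom_ext _ ?_ ?_) (CoproductOf.hom_ext _ ?_ ?_) <;> simp
  inv_hom_id := by
    refine CoproductOf.hom_ext _ (PushoutOf.hom_ext _ ?_ ?_) (PushoutOf.hom_ext _ ?_ ?_) <;> simp

/-- `L (X ⊔ Y) ≅ L X ⊔ L Y`. -/
def sumCop (X Y : Type u) : L.obj (X ⊕ Y) ≅ (G.cop (L.obj X) (L.obj Y)).pt where
  hom := G.leg (𝟙 _) (𝟙 _)
  inv := (G.cop _ _).desc (L.map (SetSum.inl X Y)) (L.map (SetSum.inr X Y))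
  hom_inv_id := by apply G.sum_hom_ext <;> simp
  inv_hom_id := by refine CoproductOf.hom_ext _ ?_ ?_ <;> simp

end Gluing

namespace Gluing

variable {C : Type w} [Category.{v} C] {L : Type u ⥤ C} (G : Gluing L)

/-! The operations of the double category of structured cospans. -/

/-- Horizontal composition of structured cospans, by pushout over the common foot. -/
abbrev hcomp {X Y Z : Type u} (M : OpenHor L X Y) (N : OpenHor L Y Z) : OpenHor L X Z where
  apex := (G.push M.out N.inp).pt
  inp := M.inp ≫ (G.push M.out N.inp).inl
  out := N.out ≫ (G.push M.out N.inp).inr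

/-- Horizontal composition of rectangles with a common side. -/
abbrev hcompMap {X Y Z X' Y' Z' : Type u} {M : OpenHor L X Y} {N : OpenHor L Y Z}
    {M' : OpenHor L X' Y'} {N' : OpenHor L Y' Z'} (α : ⟪M⟫ ⟶ ⟪M'⟫) (β : ⟪N⟫ ⟶ ⟪N'⟫)
    (h : α.right = β.left) : ⟪G.hcomp M N⟫ ⟶ ⟪G.hcomp M' N'⟫ where
  left := α.left
  right := β.right
  mid := G.pushMap (L.map α.right) α.mid β.mid α.out_comm (by rw [h]; exact β.inp_comm)
  inp_comm := by
    have := α.inp_comm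
    simp only [Category.assoc, PushoutOf.inl_desc]
    rw [← Category.assoc, this, Category.assoc]
  out_comm := by
    have := β.out_comm
    simp only [Category.assoc, PushoutOf.inr_desc]
    rw [← Category.assoc, this, Category.assoc]

/-- The coproduct of structured cospans. -/
abbrev tensorHor {X Y X' Y' : Type u} (M : OpenHor L X Y) (N : OpenHor L X' Y') :
    OpenHor L (X ⊕ X') (Y ⊕ Y') where
  apex := (G.cop M.apex N.apex).pt
  inp := G.leg M.inp N.inp
  out := G.leg M.out N.out

/-- The coproduct of rectangles. -/
abbrev tensorMap {X₁ Y₁ X₂ Y₂ X₁' Y₁' X₂' Y₂' : Type u} {M : OpenHor L X₁ Y₁}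
    {N : OpenHor L X₂ Y₂} {M' : OpenHor L X₁' Y₁'} {N' : OpenHor L X₂' Y₂'}
    (α : ⟪M⟫ ⟶ ⟪M'⟫) (β : ⟪N⟫ ⟶ ⟪N'⟫) : ⟪G.tensorHor M N⟫ ⟶ ⟪G.tensorHor M' N'⟫ where
  left := SetSum.map α.left β.left
  right := SetSum.map α.right β.right
  mid := G.copMap α.mid β.mid
  inp_comm := by
    have h₁ := α.inp_comm
    have h₂ := β.inp_comm
    dsimp only at h₁ h₂ ⊢
    rw [G.map_sumDesc, G.sumDesc_comp, ← Category.assoc, ← Category.assoc, h₁, h₂]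
    simp
  out_comm := by
    have h₁ := α.out_comm
    have h₂ := β.out_comm
    dsimp only at h₁ h₂ ⊢
    rw [G.map_sumDesc, G.sumDesc_comp, ← Category.assoc, ← Category.assoc, h₁, h₂]
    simp

/-- The horizontal identity. -/
abbrev hid (L : Type u ⥤ C) (X : Type u) : OpenHor L X X := ⟨L.obj X, 𝟙 _, 𝟙 _⟩

/-- The identity rectangle on a function. -/
abbrev hidMap (L : Type u ⥤ C) {X Y : Type u} (f : X ⟶ Y) : ⟪hid L X⟫ ⟶ ⟪hid L Y⟫ where
  left := f
  right := f
  mid := L.map f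
  inp_comm := by simp
  out_comm := by simp

/-- The associativity constraint for horizontal composition. -/
def hassoc {W X Y Z : Type u} (M : OpenHor L W X) (N : OpenHor L X Y) (P : OpenHor L Y Z) :
    ⟪G.hcomp (G.hcomp M N) P⟫ ≅ ⟪G.hcomp M (G.hcomp N P)⟫ :=
  OpenCell.isoMk (Iso.refl _) (Iso.refl _)
    (G.pushAssoc M.out N.inp N.out P.inp) (by simp [pushAssoc]) (by simp [pushAssoc])

/-- The left unit constraint for horizontal composition. -/
def hlunit {X Y : Type u} (M : OpenHor L X Y) : ⟪G.hcomp (hid L X) M⟫ ≅ ⟪M⟫ :=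
  OpenCell.isoMk (Iso.refl _) (Iso.refl _) (G.pushLeftUnit M.inp)
    (by simp [pushLeftUnit]) (by simp [pushLeftUnit])

/-- The right unit constraint for horizontal composition. -/
def hrunit {X Y : Type u} (M : OpenHor L X Y) : ⟪G.hcomp M (hid L Y)⟫ ≅ ⟪M⟫ :=
  OpenCell.isoMk (Iso.refl _) (Iso.refl _) (G.pushRightUnit M.out)
    (by simp [pushRightUnit]) (by simp [pushRightUnit])

/-- The (pseudo) double category of structured cospans: objects are sets, vertical morphisms are
functions, horizontal arrows are cospans `L X ⟶ apex ⟵ L Y`, cells are commutative rectangles, with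
horizontal composition by pushout. -/
abbrev openDouble : DoubleCategory where
  Obj := Type u
  vertCat := CategoryTheory.types
  Hor := OpenHor L
  cellCat := OpenCell.category
  srcMap α := OpenCell.left α
  tgtMap α := OpenCell.right α
  srcMap_id _ := rfl
  tgtMap_id _ := rfl
  srcMap_comp _ _ := rfl
  tgtMap_comp _ _ := rfl
  hid X := hid L X
  hidMap f := hidMap L f
  srcMap_hidMap _ := rfl
  tgtMap_hidMap _ := rfl
  hidMap_id X := OpenCell.hom_ext rfl rfl (L.map_id X)
  hidMap_comp f g := OpenCell.hom_ext rfl rfl (L.map_comp f g)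
  hcomp M N := G.hcomp M N
  hcompMap α β h := G.hcompMap α β h
  srcMap_hcompMap _ _ _ := rfl
  tgtMap_hcompMap _ _ _ := rfl
  hcompMap_id M N h := by
    refine OpenCell.hom_ext rfl rfl (PushoutOf.hom_ext _ ?_ ?_) <;> simp
  hcompMap_comp α β α' β' h h' h'' := by
    refine OpenCell.hom_ext rfl rfl (PushoutOf.hom_ext _ ?_ ?_) <;> simp
  hassoc M N P := G.hassoc M N P
  srcMap_hassoc _ _ _ := rfl
  tgtMap_hassoc _ _ _ := rfl
  hassoc_naturality α β γ h₁ h₂ h₃ h₄ := by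
    refine OpenCell.hom_ext ?_ ?_ (PushoutOf.hom_ext _ (PushoutOf.hom_ext _ ?_ ?_) ?_) <;>
      simp [hassoc, OpenCell.isoMk, pushAssoc]
  hlunit M := G.hlunit M
  srcMap_hlunit _ := rfl
  tgtMap_hlunit _ := rfl
  hlunit_naturality α h := by
    have e := OpenCell.inp_comm α
    refine OpenCell.hom_ext ?_ ?_ (PushoutOf.hom_ext _ ?_ ?_) <;>
      simp [hlunit, OpenCell.isoMk, pushLeftUnit]
    exact e
  hrunit M := G.hrunit M
  srcMap_hrunit _ := rfl
  tgtMap_hrunit _ := rfl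
  hrunit_naturality α h := by
    have e := OpenCell.out_comm α
    refine OpenCell.hom_ext ?_ ?_ (PushoutOf.hom_ext _ ?_ ?_) <;>
      simp [hrunit, OpenCell.isoMk, pushRightUnit]
    exact e
  hpentagon M N P Q h₁ h₂ := by
    refine OpenCell.hom_ext ?_ ?_
      (PushoutOf.hom_ext _ (PushoutOf.hom_ext _ (PushoutOf.hom_ext _ ?_ ?_) ?_) ?_) <;>
      simp [hassoc, OpenCell.isoMk, pushAssoc]
  htriangle M N h₁ h₂ := by
    refine OpenCell.hom_ext ?_ ?_
      (PushoutOf.hom_ext _ (PushoutOf.hom_ext _ ?_ ?_) ?_) <;>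
      simp [hassoc, hlunit, hrunit, OpenCell.isoMk, pushAssoc, pushLeftUnit, pushRightUnit,
        (G.push M.out N.inp).condition]

theorem map_sumAssoc_sumDesc {X Y Z : Type u} {T : C} (f : L.obj X ⟶ T) (g : L.obj Y ⟶ T)
    (h : L.obj Z ⟶ T) :
    L.map (↾(Equiv.sumAssoc X Y Z)) ≫ G.sumDesc f (G.sumDesc g h) =
      G.sumDesc (G.sumDesc f g) h := by
  refine G.sum_hom_ext (G.sum_hom_ext ?_ ?_) ?_
  · simp only [inl_sumDesc]
    rw [← L.map_comp_assoc, ← L.map_comp_assoc]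
    exact G.inl_sumDesc f (G.sumDesc g h)
  · simp only [inl_sumDesc, inr_sumDesc]
    rw [← L.map_comp_assoc, ← L.map_comp_assoc]
    refine Eq.trans ?_ (G.inl_sumDesc g h)
    conv_rhs => rw [← G.inr_sumDesc f (G.sumDesc g h), ← L.map_comp_assoc]
    rfl
  · simp only [inr_sumDesc]
    rw [← L.map_comp_assoc]
    refine Eq.trans ?_ (G.inr_sumDesc g h)
    conv_rhs => rw [← G.inr_sumDesc f (G.sumDesc g h), ← L.map_comp_assoc]
    rfl

theorem map_sumComm_sumDesc {X Y : Type u} {T : C} (f : L.obj X ⟶ T) (g : L.obj Y ⟶ T) :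
    L.map (↾Sum.swap) ≫ G.sumDesc f g = G.sumDesc g f := by
  refine G.sum_hom_ext ?_ ?_
  · rw [inl_sumDesc, ← L.map_comp_assoc]
    exact G.inr_sumDesc f g
  · rw [inr_sumDesc, ← L.map_comp_assoc]
    exact G.inl_sumDesc f g

theorem map_emptySum {X : Type u} {T : C} (f : L.obj X ⟶ T) :
    L.map (↾(Equiv.emptySum PEmpty.{u + 1} X)) ≫ f = G.sumDesc (G.emptyDesc T) f := by
  refine G.sum_hom_ext (G.empty_hom_ext _ _) ?_
  rw [inr_sumDesc, ← L.map_comp_assoc,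
    show SetSum.inr PEmpty X ≫ ↾(Equiv.emptySum PEmpty.{u + 1} X) = 𝟙 X from rfl]
  simp

theorem map_sumEmpty {X : Type u} {T : C} (f : L.obj X ⟶ T) :
    L.map (↾(Equiv.sumEmpty X PEmpty.{u + 1})) ≫ f = G.sumDesc f (G.emptyDesc T) := by
  refine G.sum_hom_ext ?_ (G.empty_hom_ext _ _)
  rw [inl_sumDesc, ← L.map_comp_assoc,
    show SetSum.inl X PEmpty ≫ ↾(Equiv.sumEmpty X PEmpty.{u + 1}) = 𝟙 X from rfl]
  simp

/-- The associator of the coproduct of structured cospans. -/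
def tassoc {X₁ Y₁ X₂ Y₂ X₃ Y₃ : Type u} (M : OpenHor L X₁ Y₁) (N : OpenHor L X₂ Y₂)
    (P : OpenHor L X₃ Y₃) :
    ⟪G.tensorHor (G.tensorHor M N) P⟫ ≅ ⟪G.tensorHor M (G.tensorHor N P)⟫ :=
  OpenCell.isoMk (SetSum.isoOfEquiv (Equiv.sumAssoc _ _ _))
    (SetSum.isoOfEquiv (Equiv.sumAssoc _ _ _)) (G.copAssoc M.apex N.apex P.apex)
    (by simp [copAssoc, leg, sumDesc_comp, map_sumAssoc_sumDesc])
    (by simp [copAssoc, leg, sumDesc_comp, map_sumAssoc_sumDesc])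

/-- The left unitor of the coproduct of structured cospans. -/
def tlunit {X Y : Type u} (M : OpenHor L X Y) : ⟪G.tensorHor (hid L PEmpty) M⟫ ≅ ⟪M⟫ :=
  OpenCell.isoMk (SetSum.isoOfEquiv (Equiv.emptySum _ _)) (SetSum.isoOfEquiv (Equiv.emptySum _ _))
    (G.copLeftUnit M.apex)
    (by simp [copLeftUnit, leg, sumDesc_comp, ← map_emptySum])
    (by simp [copLeftUnit, leg, sumDesc_comp, ← map_emptySum])

/-- The right unitor of the coproduct of structured cospans. -/
def trunit {X Y : Type u} (M : OpenHor L X Y) : ⟪G.tensorHor M (hid L PEmpty)⟫ ≅ ⟪M⟫ :=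
  OpenCell.isoMk (SetSum.isoOfEquiv (Equiv.sumEmpty _ _)) (SetSum.isoOfEquiv (Equiv.sumEmpty _ _))
    (G.copRightUnit M.apex)
    (by simp [copRightUnit, leg, sumDesc_comp, ← map_sumEmpty])
    (by simp [copRightUnit, leg, sumDesc_comp, ← map_sumEmpty])

/-- The braiding of the coproduct of structured cospans. -/
def tbraid {X₁ Y₁ X₂ Y₂ : Type u} (M : OpenHor L X₁ Y₁) (N : OpenHor L X₂ Y₂) :
    ⟪G.tensorHor M N⟫ ≅ ⟪G.tensorHor N M⟫ :=
  OpenCell.isoMk (SetSum.isoOfEquiv (Equiv.sumComm _ _)) (SetSum.isoOfEquiv (Equiv.sumComm _ _))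
    (G.copComm M.apex N.apex)
    (by simp [copComm, leg, sumDesc_comp, map_sumComm_sumDesc])
    (by simp [copComm, leg, sumDesc_comp, map_sumComm_sumDesc])

/-- The interchange isomorphism between coproducts and horizontal composites. -/
def interchange {X Y Z X' Y' Z' : Type u} (M₁ : OpenHor L X Y) (N₁ : OpenHor L X' Y')
    (M₂ : OpenHor L Y Z) (N₂ : OpenHor L Y' Z') :
    ⟪G.hcomp (G.tensorHor M₁ N₁) (G.tensorHor M₂ N₂)⟫ ≅
      ⟪G.tensorHor (G.hcomp M₁ M₂) (G.hcomp N₁ N₂)⟫ :=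
  OpenCell.isoMk (Iso.refl _) (Iso.refl _) (G.pushCop M₁.out N₁.out M₂.inp N₂.inp)
    (by simp [pushCop, leg, sumDesc_comp]) (by simp [pushCop, leg, sumDesc_comp])

/-- The coproduct of horizontal identities. -/
def tensorHid (X Y : Type u) : ⟪hid L (X ⊕ Y)⟫ ≅ ⟪G.tensorHor (hid L X) (hid L Y)⟫ :=
  OpenCell.isoMk (Iso.refl _) (Iso.refl _) (G.sumCop X Y) (by simp [sumCop]) (by simp [sumCop])


/-! Coherence of the above isomorphisms. -/

theorem tlunit_naturality {X Y X' Y' : Type u} {M : OpenHor L X Y} {M' : OpenHor L X' Y'}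
    (α : ⟪M⟫ ⟶ ⟪M'⟫) :
    G.tensorMap (𝟙 ⟪hid L PEmpty⟫) α ≫ (G.tlunit M').hom = (G.tlunit M).hom ≫ α := by
  refine OpenCell.hom_ext ?_ ?_ (CoproductOf.hom_ext _ (G.empty_hom_ext _ _) ?_)
  · ext x; rcases x with x | x
    · exact x.elim
    · rfl
  · ext x; rcases x with x | x
    · exact x.elim
    · rfl
  · simp [tlunit, OpenCell.isoMk, copLeftUnit]

theorem trunit_naturality {X Y X' Y' : Type u} {M : OpenHor L X Y} {M' : OpenHor L X' Y'}
    (α : ⟪M⟫ ⟶ ⟪M'⟫) :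
    G.tensorMap α (𝟙 ⟪hid L PEmpty⟫) ≫ (G.trunit M').hom = (G.trunit M).hom ≫ α := by
  refine OpenCell.hom_ext ?_ ?_ (CoproductOf.hom_ext _ ?_ (G.empty_hom_ext _ _))
  · ext x; rcases x with x | x
    · rfl
    · exact x.elim
  · ext x; rcases x with x | x
    · rfl
    · exact x.elim
  · simp [trunit, OpenCell.isoMk, copRightUnit]

theorem ttriangle {X₁ Y₁ X₂ Y₂ : Type u} (M : OpenHor L X₁ Y₁) (N : OpenHor L X₂ Y₂) :
    (G.tassoc M (hid L PEmpty) N).hom ≫ G.tensorMap (𝟙 ⟪M⟫) (G.tlunit N).hom =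
      G.tensorMap (G.trunit M).hom (𝟙 ⟪N⟫) := by
  refine OpenCell.hom_ext ?_ ?_
    (CoproductOf.hom_ext _ (CoproductOf.hom_ext _ ?_ (G.empty_hom_ext _ _)) ?_)
  · ext x; rcases x with (x | x) | x
    · rfl
    · exact x.elim
    · rfl
  · ext x; rcases x with (x | x) | x
    · rfl
    · exact x.elim
    · rfl
  all_goals simp [tassoc, tlunit, trunit, OpenCell.isoMk, copAssoc, copLeftUnit, copRightUnit]

theorem tensorHid_naturality {X Y X' Y' : Type u} (f : X ⟶ X') (g : Y ⟶ Y') :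
    hidMap L (SetSum.map f g) ≫ (G.tensorHid X' Y').hom =
      (G.tensorHid X Y).hom ≫ G.tensorMap (hidMap L f) (hidMap L g) := by
  refine OpenCell.hom_ext rfl rfl ?_
  simp [tensorHid, OpenCell.isoMk, sumCop, leg, G.map_sumDesc, sumDesc_comp]

theorem interchange_hassoc {W X Y Z W' X' Y' Z' : Type u} (M₁ : OpenHor L W X)
    (N₁ : OpenHor L W' X') (M₂ : OpenHor L X Y) (N₂ : OpenHor L X' Y') (M₃ : OpenHor L Y Z)
    (N₃ : OpenHor L Y' Z') :
    G.hcompMap (G.interchange M₁ N₁ M₂ N₂).hom (𝟙 ⟪G.tensorHor M₃ N₃⟫) rfl ≫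
        (G.interchange (G.hcomp M₁ M₂) (G.hcomp N₁ N₂) M₃ N₃).hom ≫
        G.tensorMap (G.hassoc M₁ M₂ M₃).hom (G.hassoc N₁ N₂ N₃).hom =
      (G.hassoc (G.tensorHor M₁ N₁) (G.tensorHor M₂ N₂) (G.tensorHor M₃ N₃)).hom ≫
        G.hcompMap (𝟙 ⟪G.tensorHor M₁ N₁⟫) (G.interchange M₂ N₂ M₃ N₃).hom rfl ≫
        (G.interchange M₁ N₁ (G.hcomp M₂ M₃) (G.hcomp N₂ N₃)).hom := by
  refine OpenCell.hom_ext ?_ ?_ (PushoutOf.hom_ext _ (PushoutOf.hom_ext _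
    (CoproductOf.hom_ext _ ?_ ?_) (CoproductOf.hom_ext _ ?_ ?_)) (CoproductOf.hom_ext _ ?_ ?_))
  · ext x; rcases x with x | x <;> rfl
  · ext x; rcases x with x | x <;> rfl
  all_goals simp [interchange, hassoc, OpenCell.isoMk, pushCop, pushAssoc]

theorem interchange_hlunit {X Y X' Y' : Type u} (M : OpenHor L X Y) (N : OpenHor L X' Y') :
    G.hcompMap (G.tensorHid X X').hom (𝟙 ⟪G.tensorHor M N⟫) rfl ≫
        (G.interchange (hid L X) (hid L X') M N).hom ≫
        G.tensorMap (G.hlunit M).hom (G.hlunit N).hom =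
      (G.hlunit (G.tensorHor M N)).hom := by
  refine OpenCell.hom_ext ?_ ?_ (PushoutOf.hom_ext _ (G.sum_hom_ext ?_ ?_)
    (CoproductOf.hom_ext _ ?_ ?_))
  · ext x; rcases x with x | x <;> rfl
  · ext x; rcases x with x | x <;> rfl
  all_goals simp [interchange, tensorHid, hlunit, OpenCell.isoMk, pushCop, pushLeftUnit, sumCop,
    leg]

theorem interchange_hrunit {X Y X' Y' : Type u} (M : OpenHor L X Y) (N : OpenHor L X' Y') :
    G.hcompMap (𝟙 ⟪G.tensorHor M N⟫) (G.tensorHid Y Y').hom rfl ≫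
        (G.interchange M N (hid L Y) (hid L Y')).hom ≫
        G.tensorMap (G.hrunit M).hom (G.hrunit N).hom =
      (G.hrunit (G.tensorHor M N)).hom := by
  refine OpenCell.hom_ext ?_ ?_ (PushoutOf.hom_ext _ (CoproductOf.hom_ext _ ?_ ?_)
    (G.sum_hom_ext ?_ ?_))
  · ext x; rcases x with x | x <;> rfl
  · ext x; rcases x with x | x <;> rfl
  all_goals simp [interchange, tensorHid, hrunit, OpenCell.isoMk, pushCop, pushRightUnit, sumCop,
    leg]

theorem tassoc_hid (X Y Z : Type u) :
    hidMap L (↾(Equiv.sumAssoc X Y Z)) ≫ (G.tensorHid X (Y ⊕ Z)).hom ≫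
        G.tensorMap (𝟙 ⟪hid L X⟫) (G.tensorHid Y Z).hom =
      (G.tensorHid (X ⊕ Y) Z).hom ≫ G.tensorMap (G.tensorHid X Y).hom (𝟙 ⟪hid L Z⟫) ≫
        (G.tassoc (hid L X) (hid L Y) (hid L Z)).hom := by
  refine OpenCell.hom_ext ?_ ?_ ?_
  · ext x; rcases x with (x | x) | x <;> rfl
  · ext x; rcases x with (x | x) | x <;> rfl
  · simp [tensorHid, tassoc, OpenCell.isoMk, sumCop, leg, sumDesc_comp, map_sumAssoc_sumDesc,
      copAssoc]

theorem tlunit_hcomp {X Y Z : Type u} (M : OpenHor L X Y) (N : OpenHor L Y Z) :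
    (G.interchange (hid L PEmpty) M (hid L PEmpty) N).hom ≫
        G.tensorMap (G.hlunit (hid L PEmpty)).hom (𝟙 ⟪G.hcomp M N⟫) ≫ (G.tlunit (G.hcomp M N)).hom =
      G.hcompMap (G.tlunit M).hom (G.tlunit N).hom rfl := by
  refine OpenCell.hom_ext ?_ ?_ (PushoutOf.hom_ext _
    (CoproductOf.hom_ext _ (G.empty_hom_ext _ _) ?_)
    (CoproductOf.hom_ext _ (G.empty_hom_ext _ _) ?_))
  · ext x; rcases x with x | x
    · exact x.elim
    · rfl
  · ext x; rcases x with x | x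
    · exact x.elim
    · rfl
  all_goals simp [interchange, tlunit, OpenCell.isoMk, pushCop, copLeftUnit]

theorem trunit_hcomp {X Y Z : Type u} (M : OpenHor L X Y) (N : OpenHor L Y Z) :
    (G.interchange M (hid L PEmpty) N (hid L PEmpty)).hom ≫
        G.tensorMap (𝟙 ⟪G.hcomp M N⟫) (G.hlunit (hid L PEmpty)).hom ≫ (G.trunit (G.hcomp M N)).hom =
      G.hcompMap (G.trunit M).hom (G.trunit N).hom rfl := by
  refine OpenCell.hom_ext ?_ ?_ (PushoutOf.hom_ext _
    (CoproductOf.hom_ext _ ?_ (G.empty_hom_ext _ _))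
    (CoproductOf.hom_ext _ ?_ (G.empty_hom_ext _ _)))
  · ext x; rcases x with x | x
    · rfl
    · exact x.elim
  · ext x; rcases x with x | x
    · rfl
    · exact x.elim
  all_goals simp [interchange, trunit, OpenCell.isoMk, pushCop, copRightUnit]

theorem tlunit_hid (X : Type u) :
    (G.tensorHid PEmpty X).hom ≫ (G.tlunit (hid L X)).hom =
      hidMap L (↾(Equiv.emptySum PEmpty.{u + 1} X)) := by
  refine OpenCell.hom_ext ?_ ?_ (G.sum_hom_ext (G.empty_hom_ext _ _) ?_)
  · ext x; rcases x with x | x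
    · exact x.elim
    · rfl
  · ext x; rcases x with x | x
    · exact x.elim
    · rfl
  · have := G.map_emptySum (𝟙 (L.obj X))
    simp only [Category.comp_id] at this
    simp [tensorHid, tlunit, OpenCell.isoMk, sumCop, leg, copLeftUnit, this]

theorem trunit_hid (X : Type u) :
    (G.tensorHid X PEmpty).hom ≫ (G.trunit (hid L X)).hom =
      hidMap L (↾(Equiv.sumEmpty X PEmpty.{u + 1})) := by
  refine OpenCell.hom_ext ?_ ?_ (G.sum_hom_ext ?_ (G.empty_hom_ext _ _))
  · ext x; rcases x with x | x
    · rfl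
    · exact x.elim
  · ext x; rcases x with x | x
    · rfl
    · exact x.elim
  · have := G.map_sumEmpty (𝟙 (L.obj X))
    simp only [Category.comp_id] at this
    simp [tensorHid, trunit, OpenCell.isoMk, sumCop, leg, copRightUnit, this]

theorem tbraid_hid (X Y : Type u) :
    (G.tensorHid X Y).hom ≫ (G.tbraid (hid L X) (hid L Y)).hom =
      hidMap L (↾(Equiv.sumComm X Y)) ≫ (G.tensorHid Y X).hom := by
  refine OpenCell.hom_ext ?_ ?_ ?_
  · ext x; rcases x with x | x <;> rfl
  · ext x; rcases x with x | x <;> rfl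
  · simp [tensorHid, tbraid, OpenCell.isoMk, sumCop, leg, copComm, sumDesc_comp,
      map_sumComm_sumDesc]

/-- The symmetric monoidal double category of structured cospans, with horizontal composition by
pushout and tensor product by disjoint union. -/
def openSymMon : SymMonDoubleCategory where
  toDoubleCategory := G.openDouble
  mon := SetSum.monoidal
  symm := SetSum.symmetric
  tensorHor M N := G.tensorHor M N
  tensorMap α β := G.tensorMap α β
  srcMap_tensorMap _ _ := rfl
  tgtMap_tensorMap _ _ := rfl
  tensorMap_id M N := by
    refine OpenCell.hom_ext ?_ ?_ (CoproductOf.hom_ext _ ?_ ?_)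
    · ext x; rcases x with x | x <;> rfl
    · ext x; rcases x with x | x <;> rfl
    · simp
    · simp
  tensorMap_comp α β α' β' := by
    refine OpenCell.hom_ext ?_ ?_ (CoproductOf.hom_ext _ ?_ ?_)
    · ext x; rcases x with x | x <;> rfl
    · ext x; rcases x with x | x <;> rfl
    · simp
    · simp
  tassoc M N P := G.tassoc M N P
  srcMap_tassoc _ _ _ := rfl
  tgtMap_tassoc _ _ _ := rfl
  tassoc_naturality α β γ := by
    refine OpenCell.hom_ext ?_ ?_ (CoproductOf.hom_ext _ (CoproductOf.hom_ext _ ?_ ?_) ?_)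
    · ext x; rcases x with (x | x) | x <;> rfl
    · ext x; rcases x with (x | x) | x <;> rfl
    all_goals simp [tassoc, OpenCell.isoMk, copAssoc]
  tlunit M := G.tlunit M
  srcMap_tlunit _ := rfl
  tgtMap_tlunit _ := rfl
  tlunit_naturality _ := G.tlunit_naturality _
  trunit M := G.trunit M
  srcMap_trunit _ := rfl
  tgtMap_trunit _ := rfl
  trunit_naturality _ := G.trunit_naturality _
  tbraid M N := G.tbraid M N
  srcMap_tbraid _ _ := rfl
  tgtMap_tbraid _ _ := rfl
  tbraid_naturality α β := by
    refine OpenCell.hom_ext ?_ ?_ (CoproductOf.hom_ext _ ?_ ?_)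
    · ext x; rcases x with x | x <;> rfl
    · ext x; rcases x with x | x <;> rfl
    all_goals simp [tbraid, OpenCell.isoMk, copComm]
  tpentagon M N P Q := by
    refine OpenCell.hom_ext ?_ ?_
      (CoproductOf.hom_ext _ (CoproductOf.hom_ext _ (CoproductOf.hom_ext _ ?_ ?_) ?_) ?_)
    · ext x; rcases x with ((x | x) | x) | x <;> rfl
    · ext x; rcases x with ((x | x) | x) | x <;> rfl
    all_goals simp [tassoc, OpenCell.isoMk, copAssoc]
  ttriangle _ _ := G.ttriangle _ _
  thexagon M N P := by
    refine OpenCell.hom_ext ?_ ?_ (CoproductOf.hom_ext _ (CoproductOf.hom_ext _ ?_ ?_) ?_)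
    · ext x; rcases x with (x | x) | x <;> rfl
    · ext x; rcases x with (x | x) | x <;> rfl
    all_goals simp [tassoc, tbraid, OpenCell.isoMk, copAssoc, copComm]
  tsymmetry M N := by
    refine OpenCell.hom_ext ?_ ?_ (CoproductOf.hom_ext _ ?_ ?_)
    · ext x; rcases x with x | x <;> rfl
    · ext x; rcases x with x | x <;> rfl
    all_goals simp [tbraid, OpenCell.isoMk, copComm]
  interchange M₁ N₁ M₂ N₂ := G.interchange M₁ N₁ M₂ N₂
  srcMap_interchange _ _ _ _ := rfl
  tgtMap_interchange _ _ _ _ := rfl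
  interchange_naturality α₁ β₁ α₂ β₂ h₁ h₂ h₃ := by
    refine OpenCell.hom_ext rfl rfl (PushoutOf.hom_ext _ (CoproductOf.hom_ext _ ?_ ?_)
      (CoproductOf.hom_ext _ ?_ ?_)) <;>
    simp [openDouble, interchange, OpenCell.isoMk, pushCop]
  tensorHid X Y := G.tensorHid X Y
  srcMap_tensorHid _ _ := rfl
  tgtMap_tensorHid _ _ := rfl
  tensorHid_naturality _ _ := G.tensorHid_naturality _ _
  interchange_hassoc _ _ _ _ _ _ _ _ := G.interchange_hassoc _ _ _ _ _ _
  interchange_hlunit _ _ _ := G.interchange_hlunit _ _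
  interchange_hrunit _ _ _ := G.interchange_hrunit _ _
  tassoc_hcomp M₁ N₁ P₁ M₂ N₂ P₂ h := by
    refine OpenCell.hom_ext ?_ ?_ (PushoutOf.hom_ext _
      (CoproductOf.hom_ext _ (CoproductOf.hom_ext _ ?_ ?_) ?_)
      (CoproductOf.hom_ext _ (CoproductOf.hom_ext _ ?_ ?_) ?_))
    · ext x; rcases x with (x | x) | x <;> rfl
    · ext x; rcases x with (x | x) | x <;> rfl
    all_goals simp [openDouble, interchange, tassoc, OpenCell.isoMk, pushCop, copAssoc]
  tassoc_hid _ _ _ := G.tassoc_hid _ _ _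
  tlunit_hcomp _ _ _ := G.tlunit_hcomp _ _
  tlunit_hid _ := G.tlunit_hid _
  trunit_hcomp _ _ _ := G.trunit_hcomp _ _
  trunit_hid _ := G.trunit_hid _
  tbraid_hcomp M₁ N₁ M₂ N₂ h := by
    refine OpenCell.hom_ext ?_ ?_ (PushoutOf.hom_ext _ (CoproductOf.hom_ext _ ?_ ?_)
      (CoproductOf.hom_ext _ ?_ ?_))
    · ext x; rcases x with x | x <;> rfl
    · ext x; rcases x with x | x <;> rfl
    all_goals simp [openDouble, interchange, tbraid, OpenCell.isoMk, pushCop, copComm]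
  tbraid_hid _ _ := G.tbraid_hid _ _

end Gluing

/-! ### Matrices over a quantale -/

/-- A square matrix with entries in `R`, indexed by a set. -/
structure RMat (R : Type v) where
  carrier : Type u
  mat : carrier → carrier → R

section Matrices

variable {R : Type v} [CommMonoid R] [CompleteLattice R]

/-- The matrix product. -/
def matMul {X Y Z : Type u} (M : X → Y → R) (N : Y → Z → R) : X → Z → R :=
  fun i k => ⨆ j, M i j * N j k

open Classical in
/-- The identity matrix: `1` on the diagonal and the least element `0` of `R` elsewhere. -/
noncomputable def matOne (X : Type u) : X → X → R := fun i j => if i = j then 1 else ⊥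

/-- The powers of a square matrix. -/
noncomputable def matPow {X : Type u} (M : X → X → R) : ℕ → X → X → R
  | 0 => matOne X
  | n + 1 => matMul (matPow M n) M

/-- The solution `∑ₙ Mⁿ` of the algebraic path problem; sums are joins. -/
noncomputable def pathMat {X : Type u} (M : X → X → R) : X → X → R :=
  fun i j => ⨆ n : ℕ, matPow M n i j

/-- The pushforward of a matrix along a function. -/
def pushforward {X Y : Type u} (f : X → Y) (M : X → X → R) : Y → Y → R :=
  fun y y' => ⨆ (x : X) (x' : X) (_ : f x = y ∧ f x' = y'), M x x'

end Matrices

theorem pushforward_le_iff {R : Type v} [CompleteLattice R] {X Y : Type u} {f : X → Y}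
    {M : X → X → R} {N : Y → Y → R} :
    pushforward f M ≤ N ↔ ∀ x x', M x x' ≤ N (f x) (f x') := by
  constructor
  · intro h x x'
    refine le_trans ?_ (h (f x) (f x'))
    exact le_iSup_of_le x (le_iSup_of_le x' (le_iSup_of_le ⟨rfl, rfl⟩ le_rfl))
  · intro h y y'
    refine iSup_le fun x => iSup_le fun x' => iSup_le fun e => ?_
    rw [← e.1, ← e.2]
    exact h x x'

theorem le_pushforward {R : Type v} [CompleteLattice R] {X Y : Type u} (f : X → Y)
    (M : X → X → R) (x x' : X) : M x x' ≤ pushforward f M (f x) (f x') :=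
  pushforward_le_iff.1 le_rfl x x'

/-- A morphism of matrices is a function on indices whose pushforward of the first matrix is at most
the second. -/
@[ext] structure RMat.Hom {R : Type v} [CompleteLattice R] (M N : RMat.{u} R) where
  toFun : M.carrier → N.carrier
  le : pushforward toFun M.mat ≤ N.mat

namespace RMat

/-- The category of square matrices. -/
instance category {R : Type v} [CompleteLattice R] : Category.{u} (RMat.{u} R) where
  Hom := Hom
  id M := ⟨id, pushforward_le_iff.2 fun _ _ => le_rfl⟩
  comp f g := ⟨g.toFun ∘ f.toFun, pushforward_le_iff.2 fun x x' =>
    (pushforward_le_iff.1 f.le x x').trans (pushforward_le_iff.1 g.le _ _)⟩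

section

variable {R : Type v} [CompleteLattice R]

theorem hom_ext {M N : RMat.{u} R} {f g : M ⟶ N} (h : ∀ x, f.toFun x = g.toFun x) : f = g :=
  Hom.ext (funext h)

theorem hom_le {M N : RMat.{u} R} (f : M ⟶ N) (x x' : M.carrier) :
    M.mat x x' ≤ N.mat (f.toFun x) (f.toFun x') := pushforward_le_iff.1 (Hom.le f) x x'

/-- A morphism from an entrywise inequality. -/
abbrev homMk {M N : RMat.{u} R} (f : M.carrier → N.carrier)
    (h : ∀ x x', M.mat x x' ≤ N.mat (f x) (f x')) : M ⟶ N where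
  toFun := f
  le := pushforward_le_iff.2 h

/-- The functor sending a set to the zero matrix on it. -/
def zero (R : Type v) [CompleteLattice R] : Type u ⥤ RMat.{u} R where
  obj X := ⟨X, fun _ _ => ⊥⟩
  map f := homMk f fun _ _ => bot_le

/-- The pushout of matrices: on the pushout of the index sets, the pointwise sum of the
pushforwards. -/
def push {K G H : RMat.{u} R} (f : K ⟶ G) (g : K ⟶ H) : PushoutOf f g where
  pt :=
    { carrier := Limits.Types.Pushout (↾f.toFun) (↾g.toFun)
      mat := pushforward (Limits.Types.Pushout.inl (↾f.toFun) (↾g.toFun)) G.mat ⊔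
        pushforward (Limits.Types.Pushout.inr (↾f.toFun) (↾g.toFun)) H.mat }
  inl := homMk (Limits.Types.Pushout.inl (↾f.toFun) (↾g.toFun)) fun x x' =>
    le_sup_of_le_left (le_pushforward _ G.mat x x')
  inr := homMk (Limits.Types.Pushout.inr (↾f.toFun) (↾g.toFun)) fun x x' =>
    le_sup_of_le_right (le_pushforward _ H.mat x x')
  condition := hom_ext fun x => Quot.sound (Limits.Types.Pushout.Rel.inl_inr x)
  desc {Z} h k e :=
    { toFun := Quot.lift (Sum.elim h.toFun k.toFun) (by
        rintro _ _ ⟨s⟩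
        exact congrFun (congrArg Hom.toFun e) s)
      le := pushforward_le_iff.2 fun p p' => sup_le
        (iSup_le fun x => iSup_le fun x' => iSup_le fun e => by
          rw [← e.1, ← e.2]; exact hom_le h x x')
        (iSup_le fun x => iSup_le fun x' => iSup_le fun e => by
          rw [← e.1, ← e.2]; exact hom_le k x x') }
  inl_desc _ _ _ := rfl
  inr_desc _ _ _ := rfl
  hom_ext h₁ h₂ := hom_ext fun p => by
    rcases p with ⟨x | x⟩
    · exact congrFun (congrArg Hom.toFun h₁) x
    · exact congrFun (congrArg Hom.toFun h₂) x

/-- The coproduct of matrices: on the disjoint union of the index sets, the pointwise sum of the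
pushforwards. -/
def cop (G H : RMat.{u} R) : CoproductOf G H where
  pt :=
    { carrier := G.carrier ⊕ H.carrier
      mat := pushforward Sum.inl G.mat ⊔ pushforward Sum.inr H.mat }
  inl := homMk Sum.inl fun x x' => le_sup_of_le_left (le_pushforward _ G.mat x x')
  inr := homMk Sum.inr fun x x' => le_sup_of_le_right (le_pushforward _ H.mat x x')
  desc {Z} h k :=
    { toFun := Sum.elim h.toFun k.toFun
      le := pushforward_le_iff.2 fun p p' => sup_le
        (iSup_le fun x => iSup_le fun x' => iSup_le fun e => by
          rw [← e.1, ← e.2]; exact hom_le h x x')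
        (iSup_le fun x => iSup_le fun x' => iSup_le fun e => by
          rw [← e.1, ← e.2]; exact hom_le k x x') }
  inl_desc _ _ := rfl
  inr_desc _ _ := rfl
  hom_ext h₁ h₂ := hom_ext fun p => by
    rcases p with x | x
    · exact congrFun (congrArg Hom.toFun h₁) x
    · exact congrFun (congrArg Hom.toFun h₂) x

/-- The data for gluing open matrices. -/
def gluing (R : Type v) [CompleteLattice R] : Gluing (zero.{u} R) where
  push f g := push f g
  cop G H := cop G H
  sumDesc f g := homMk (Sum.elim f.toFun g.toFun) fun _ _ => bot_le
  inl_sumDesc _ _ := rfl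
  inr_sumDesc _ _ := rfl
  sum_hom_ext h₁ h₂ := hom_ext fun p => by
    rcases p with x | x
    · exact congrFun (congrArg Hom.toFun h₁) x
    · exact congrFun (congrArg Hom.toFun h₂) x
  emptyDesc Z := homMk PEmpty.elim fun _ _ => bot_le
  empty_hom_ext a b := hom_ext fun x => x.elim

end

variable {R : Type v} [CommMonoid R] [CompleteLattice R]

/-- A matrix is an `R`-category if it satisfies the identity and composition laws. -/
def IsRCat : ObjectProperty (RMat.{u} R) := fun C =>
  (∀ x, 1 ≤ C.mat x x) ∧ ∀ x y z, C.mat x y * C.mat y z ≤ C.mat x z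

end RMat

/-- The category of `R`-categories, a full subcategory of the category of matrices. -/
abbrev RCat (R : Type v) [CommMonoid R] [CompleteLattice R] :=
  (RMat.IsRCat : ObjectProperty (RMat.{u} R)).FullSubcategory

namespace RCat

variable {R : Type v} [CommMonoid R] [CompleteLattice R]

theorem matOne_le {C : RMat.{u} R} (hC : RMat.IsRCat C) {X : Type u} (f : X → C.carrier) (i j : X) :
    matOne X i j ≤ C.mat (f i) (f j) := by
  unfold matOne
  split
  · next h => rw [h]; exact hC.1 _
  · exact bot_le

theorem le_pathMat {X : Type u} (M : X → X → R) (i j : X) : M i j ≤ pathMat M i j := by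
  refine le_iSup_of_le 1 (le_iSup_of_le i ?_)
  simp [matPow, matOne]

theorem hom_ext {C D : RCat.{u} R} {f g : C ⟶ D} (h : ∀ x, f.hom.toFun x = g.hom.toFun x) :
    f = g := ObjectProperty.hom_ext _ (RMat.hom_ext h)

variable [IsQuantale R]

theorem matMul_mono {X : Type u} {M M' N N' : X → X → R} (h : M ≤ M') (h' : N ≤ N') :
    matMul M N ≤ matMul M' N' := fun i k =>
  iSup_mono fun j => mul_le_mul' (h i j) (h' j k)

theorem matPow_le {C : RMat.{u} R} (hC : RMat.IsRCat C) {X : Type u} (f : X → C.carrier)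
    {M : X → X → R} (h : ∀ i j, M i j ≤ C.mat (f i) (f j)) (n : ℕ) (i j : X) :
    matPow M n i j ≤ C.mat (f i) (f j) := by
  induction n generalizing j with
  | zero => exact matOne_le hC f i j
  | succ n ih =>
    exact iSup_le fun k => (mul_le_mul' (ih k) (h k j)).trans (hC.2 _ _ _)

theorem pathMat_le {C : RMat.{u} R} (hC : RMat.IsRCat C) {X : Type u} (f : X → C.carrier)
    {M : X → X → R} (h : ∀ i j, M i j ≤ C.mat (f i) (f j)) (i j : X) :
    pathMat M i j ≤ C.mat (f i) (f j) :=
  iSup_le fun n => matPow_le hC f h n i j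

theorem matPow_mul_le {X : Type u} (M : X → X → R) (m n : ℕ) (i j k : X) :
    matPow M m i j * matPow M n j k ≤ matPow M (m + n) i k := by
  induction n generalizing k with
  | zero =>
    change _ * matOne X j k ≤ _
    unfold matOne
    split
    · next h => rw [h, mul_one]; exact le_rfl
    · rw [Quantale.mul_bot]; exact bot_le
  | succ n ih =>
    change _ * (⨆ l, matPow M n j l * M l k) ≤ ⨆ l, matPow M (m + n) i l * M l k
    rw [Quantale.mul_iSup_distrib]
    refine iSup_mono fun l => ?_
    rw [← mul_assoc]
    exact mul_le_mul_left (ih l) _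

theorem isRCat_pathMat {X : Type u} (M : X → X → R) : RMat.IsRCat ⟨X, pathMat M⟩ := by
  refine ⟨fun x => le_iSup_of_le 0 (by simp [matPow, matOne]), fun x y z => ?_⟩
  change (⨆ m, matPow M m x y) * (⨆ n, matPow M n y z) ≤ ⨆ n, matPow M n x z
  rw [Quantale.mul_iSup_distrib]
  refine iSup_le fun n => ?_
  rw [Quantale.iSup_mul_distrib]
  exact iSup_le fun m => le_iSup_of_le (m + n) (matPow_mul_le M m n x y z)

/-- The algebraic path problem functor, sending `M` to `∑ₙ Mⁿ`. -/
noncomputable def path (R : Type v) [CommMonoid R] [CompleteLattice R] [IsQuantale R] :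
    RMat.{u} R ⥤ RCat.{u} R where
  obj M := ⟨⟨M.carrier, pathMat M.mat⟩, isRCat_pathMat M.mat⟩
  map {M N} f := ObjectProperty.homMk (RMat.homMk f.toFun (pathMat_le (isRCat_pathMat N.mat) f.toFun
    fun i j => (RMat.hom_le f i j).trans (le_pathMat _ _ _)))

theorem isRCat_matOne (X : Type u) : RMat.IsRCat (R := R) ⟨X, matOne X⟩ := by
  refine ⟨fun x => by simp [matOne], fun x y z => ?_⟩
  by_cases h : x = y
  · subst h; simp [matOne]
  · simp [matOne, h]

/-- The functor sending a set to the identity matrix on it. -/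
noncomputable def one (R : Type v) [CommMonoid R] [CompleteLattice R] [IsQuantale R] :
    Type u ⥤ RCat.{u} R where
  obj X := ⟨⟨X, matOne X⟩, isRCat_matOne X⟩
  map {X Y} f := ObjectProperty.homMk (RMat.homMk f (matOne_le (isRCat_matOne Y) f))

/-- The map `M ⟶ F M`. -/
noncomputable abbrev unit (M : RMat.{u} R) : M ⟶ ((path R).obj M).obj :=
  RMat.homMk id (le_pathMat M.mat)

/-- The extension of a map of matrices `M ⟶ C` to `F M ⟶ C`, for an `R`-category `C`. -/
noncomputable abbrev lift {M : RMat.{u} R} {C : RCat.{u} R} (f : M ⟶ C.obj) : (path R).obj M ⟶ C :=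
  ObjectProperty.homMk (RMat.homMk f.toFun (pathMat_le C.property f.toFun (RMat.hom_le f)))

/-- The pushout of `R`-categories: `F` of the pushout of the underlying matrices. -/
noncomputable def push {K G H : RCat.{u} R} (f : K ⟶ G) (g : K ⟶ H) : PushoutOf f g where
  pt := (path R).obj (RMat.push f.hom g.hom).pt
  inl := ObjectProperty.homMk ((RMat.push f.hom g.hom).inl ≫ unit _)
  inr := ObjectProperty.homMk ((RMat.push f.hom g.hom).inr ≫ unit _)
  condition := hom_ext fun x => congrFun (congrArg RMat.Hom.toFun (RMat.push f.hom g.hom).condition) x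
  desc h k e := lift ((RMat.push f.hom g.hom).desc h.hom k.hom (congrArg (fun t => t.hom) e))
  inl_desc _ _ _ := rfl
  inr_desc _ _ _ := rfl
  hom_ext h₁ h₂ := hom_ext fun p => by
    rcases p with ⟨x | x⟩
    · exact congrFun (congrArg (fun t => t.hom.toFun) h₁) x
    · exact congrFun (congrArg (fun t => t.hom.toFun) h₂) x


theorem mul_iSup_prop_le {p q : Prop} {a b c : R} (h : p → q → a * b ≤ c) :
    (⨆ _ : p, a) * (⨆ _ : q, b) ≤ c := by
  by_cases hp : p <;> by_cases hq : q
  · simpa [hp, hq] using h hp hq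
  · simp [hq]
  · simp [hp]
  · simp [hp]

theorem isRCat_cop (G H : RCat.{u} R) : RMat.IsRCat (RMat.cop G.obj H.obj).pt := by
  constructor
  · rintro (x | x)
    · exact (G.property.1 x).trans (RMat.hom_le (RMat.cop G.obj H.obj).inl x x)
    · exact (H.property.1 x).trans (RMat.hom_le (RMat.cop G.obj H.obj).inr x x)
  · intro p q r
    change (_ ⊔ _) * (_ ⊔ _) ≤ _
    simp only [Quantale.mul_sup_distrib, Quantale.sup_mul_distrib]
    refine sup_le (sup_le ?_ ?_) (sup_le ?_ ?_) <;>
    · simp only [pushforward, Quantale.mul_iSup_distrib, Quantale.iSup_mul_distrib]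
      refine iSup_le fun y => iSup_le fun y' => iSup_le fun x => iSup_le fun x' => ?_
      refine mul_iSup_prop_le fun d e => ?_
      obtain ⟨rfl, d⟩ := d
      obtain ⟨e, rfl⟩ := e
      subst d
      cases e <;> first
      | exact (G.property.2 _ _ _).trans (RMat.hom_le (RMat.cop G.obj H.obj).inl _ _)
      | exact (H.property.2 _ _ _).trans (RMat.hom_le (RMat.cop G.obj H.obj).inr _ _)

/-- The coproduct of `R`-categories is the coproduct of the underlying matrices. -/
def cop (G H : RCat.{u} R) : CoproductOf G H where
  pt := ⟨(RMat.cop G.obj H.obj).pt, isRCat_cop G H⟩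
  inl := ObjectProperty.homMk (RMat.cop G.obj H.obj).inl
  inr := ObjectProperty.homMk (RMat.cop G.obj H.obj).inr
  desc h k := ObjectProperty.homMk ((RMat.cop G.obj H.obj).desc h.hom k.hom)
  inl_desc _ _ := rfl
  inr_desc _ _ := rfl
  hom_ext h₁ h₂ := ObjectProperty.hom_ext _ ((RMat.cop G.obj H.obj).hom_ext
    (congrArg (fun t => t.hom) h₁) (congrArg (fun t => t.hom) h₂))

/-- The data for gluing open `R`-categories. -/
noncomputable def gluing (R : Type v) [CommMonoid R] [CompleteLattice R] [IsQuantale R] :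
    Gluing (one.{u} R) where
  push f g := push f g
  cop G H := cop G H
  sumDesc {X Y Z} f g := ObjectProperty.homMk (RMat.homMk (Sum.elim f.hom.toFun g.hom.toFun)
    (matOne_le Z.property _))
  inl_sumDesc _ _ := rfl
  inr_sumDesc _ _ := rfl
  sum_hom_ext h₁ h₂ := hom_ext fun p => by
    rcases p with x | x
    · exact congrFun (congrArg (fun t => t.hom.toFun) h₁) x
    · exact congrFun (congrArg (fun t => t.hom.toFun) h₂) x
  emptyDesc Z := ObjectProperty.homMk (RMat.homMk PEmpty.elim (matOne_le Z.property _))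
  empty_hom_ext a b := hom_ext fun x => x.elim

/-- The identity matrix is the free `R`-category on the zero matrix. -/
noncomputable def oneIso (R : Type v) [CommMonoid R] [CompleteLattice R] [IsQuantale R] :
    one.{u} R ≅ RMat.zero R ⋙ path R :=
  NatIso.ofComponents fun X =>
    { hom := ObjectProperty.homMk (RMat.homMk id (matOne_le (isRCat_pathMat _) id))
      inv := ObjectProperty.homMk (RMat.homMk id (pathMat_le (isRCat_matOne X) id
        fun _ _ => bot_le)) }

end RCat

/-! ### The open double categories and the underlying data of the double functor -/

/-- The symmetric monoidal double category of open `R`-matrices, i.e. of cospans `0_X → M ← 0_Y` of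
matrices. -/
abbrev openRMat (R : Type v) [CompleteLattice R] : SymMonDoubleCategory :=
  (RMat.gluing.{u} R).openSymMon

/-- The symmetric monoidal double category of open `R`-categories, i.e. of cospans `1_X → M ← 1_Y` of
`R`-categories. -/
noncomputable abbrev openRCat (R : Type v) [CommMonoid R] [CompleteLattice R] [IsQuantale R] :
    SymMonDoubleCategory :=
  (RCat.gluing.{u} R).openSymMon

/-- The open `R`-category `1_X ≅ F 0_X → F M ← F 0_Y ≅ 1_Y` of an open `R`-matrix
`0_X → M ← 0_Y`. -/
noncomputable def starHor {R : Type v} [CommMonoid R] [CompleteLattice R] [IsQuantale R]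
    {X Y : Type u} (M : OpenHor (RMat.zero.{u} R) X Y) : OpenHor (RCat.one.{u} R) X Y where
  apex := (RCat.path R).obj M.apex
  inp := (RCat.oneIso R).hom.app X ≫ (RCat.path R).map M.inp
  out := (RCat.oneIso R).hom.app Y ≫ (RCat.path R).map M.out

/-- The effect of `F` on a rectangle of open `R`-matrices. -/
noncomputable def starCell {R : Type v} [CommMonoid R] [CompleteLattice R] [IsQuantale R]
    {X Y X' Y' : Type u} {M : OpenHor (RMat.zero.{u} R) X Y} {M' : OpenHor (RMat.zero.{u} R) X' Y'}
    (α : ⟪M⟫ ⟶ ⟪M'⟫) : ⟪starHor M⟫ ⟶ ⟪starHor M'⟫ where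
  left := α.left
  right := α.right
  mid := (RCat.path R).map α.mid
  inp_comm := by
    have h := congrArg (RCat.path R).map α.inp_comm
    simp only [Functor.map_comp] at h
    dsimp only [starHor]
    rw [Category.assoc, ← h]
    exact (RCat.oneIso R).hom.naturality_assoc _ _
  out_comm := by
    have h := congrArg (RCat.path R).map α.out_comm
    simp only [Functor.map_comp] at h
    dsimp only [starHor]
    rw [Category.assoc, ← h]
    exact (RCat.oneIso R).hom.naturality_assoc _ _

/-- The assignment `★`: it is the identity on sets and functions, and applies `F` to open
`R`-matrices and to rectangles between them. -/
noncomputable def starData (R : Type v) [CommMonoid R] [CompleteLattice R] [IsQuantale R] :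
    DoubleFunctorData (openRMat.{u} R).toDoubleCategory (openRCat.{u} R).toDoubleCategory where
  vert := 𝟭 (Type u)
  hor M := starHor M
  cell α := starCell α

/-! The functor $F$ is left adjoint to the inclusion $U$. If $C$ is an $R$-category and a function
carries $M$ below $C$, the identity and composition laws of $C$ carry every power $M^n$ below $C$,
hence also the join $F(M)$. This is `pathMat_le`, packaged as `lift`; the unit of the adjunction is
the inequality $M\le F(M)$, packaged as `unit`. A left adjoint preserves colimits, so $F$ is
compatible with the pushouts that define horizontal composition and with the coproducts that define
the tensor product. Together with $1_X\cong F(0_X)$ this makes $F$ act on cospans and respect their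
gluing.

Concretely, let $a,b$ be the maps from the vertex sets of $M$ and $N$ to the pushout of these sets.
The two matrices to compare live on the same set: $F(a_*F(M)+b_*F(N))$ for the composite of the
images, and $F(a_*M+b_*N)$ for the image of the composite. The second is below the first because
$M\le F(M)$ and $N\le F(N)$. The first is below the second because $a_*F(M)$ and $b_*F(N)$ already
lie below the $R$-category $F(a_*M+b_*N)$. These two inequalities are the two directions of
`starPushIso`. For coproducts the same argument gives `pathCopIso`; there the coproduct of
$R$-categories needs no further closure, since all entries between different summands are $0$.

Coherence then costs almost nothing. A morphism of $R$-categories is a function with a property, so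
by `RCat.hom_ext` two parallel morphisms are equal once they agree on elements. All comparison maps
act as the identity on elements, and the constraints on the two sides are given by the same formulas
on sums and quotients. Each axiom therefore becomes an equality of functions on a set, checked on
representatives, where both sides compute to the same element. The order and the multiplication of
$R$ matter only for the existence of the maps, never for the equations between them. -/

/-- The identity functor is symmetric monoidal for disjoint union. -/
abbrev SetSum.braidedId : @Functor.Braided (Type u) _ SetSum.monoidal
    SetSum.symmetric.toBraidedCategory (Type u) _ SetSum.monoidal
    SetSum.symmetric.toBraidedCategory (𝟭 (Type u)) :=
  -- Types also carry a cartesian monoidal structure; fixing the instances here selects disjoint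
  -- union. The structure maps $\varepsilon$ and $\mu$ of the resulting identity functor are
  -- identities.
  letI : MonoidalCategory (Type u) := SetSum.monoidal
  letI : SymmetricCategory (Type u) := SetSum.symmetric
  inferInstance

namespace RCat

variable {R : Type v} [CommMonoid R] [CompleteLattice R] [IsQuantale R]

/-! ### Preservation of pushouts and coproducts by $F$ -/

/-- `F` preserves the pushout over the common foot of two open matrices. -/
noncomputable def starPushIso {X Y Z : Type u} (M : OpenHor (RMat.zero.{u} R) X Y)
    (N : OpenHor (RMat.zero.{u} R) Y Z) :
    (push (starHor M).out (starHor N).inp).pt ≅ (path R).obj (RMat.push M.out N.inp).pt where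
  hom := (push (starHor M).out (starHor N).inp).desc
    ((path R).map (RMat.push M.out N.inp).inl) ((path R).map (RMat.push M.out N.inp).inr)
    -- Neither $F$ nor the isomorphism $1_Y\cong F(0_Y)$ changes underlying functions, so
    -- commutativity over $1_Y$ is, elementwise, commutativity of the matrix pushout over $0_Y$.
    (hom_ext fun x => congrFun (congrArg RMat.Hom.toFun (RMat.push M.out N.inp).condition) x)
  -- The source is free on the matrix pushout, so a morphism of matrices out of that pushout is
  -- enough; its components exist because $M\le F(M)$ and $N\le F(N)$.
  inv := lift ((RMat.push M.out N.inp).desc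
    (unit M.apex ≫ (push (starHor M).out (starHor N).inp).inl.hom)
    (unit N.apex ≫ (push (starHor M).out (starHor N).inp).inr.hom)
    (RMat.hom_ext fun x => congrFun
      (congrArg (fun t => t.hom.toFun) (push (starHor M).out (starHor N).inp).condition) x))
  -- Both carriers are the same quotient of the disjoint union of vertex sets, and the composites
  -- fix every representative. A representative has to be chosen because maps out of a quotient
  -- compute only there.
  hom_inv_id := hom_ext fun p => by rcases p with ⟨x | x⟩ <;> rfl
  inv_hom_id := hom_ext fun p => by rcases p with ⟨x | x⟩ <;> rfl

/-- `F` preserves binary coproducts. -/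
noncomputable def pathCopIso (M N : RMat.{u} R) :
    (cop ((path R).obj M) ((path R).obj N)).pt ≅ (path R).obj (RMat.cop M N).pt where
  hom := (cop ((path R).obj M) ((path R).obj N)).desc
    ((path R).map (RMat.cop M N).inl) ((path R).map (RMat.cop M N).inr)
  -- Extending along $F$ requires the target to be an $R$-category; `isRCat_cop` provides this for
  -- the plain coproduct matrix of $F(M)$ and $F(N)$.
  inv := lift ((RMat.cop M N).desc
    (unit M ≫ (cop ((path R).obj M) ((path R).obj N)).inl.hom)
    (unit N ≫ (cop ((path R).obj M) ((path R).obj N)).inr.hom))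
  hom_inv_id := hom_ext fun p => by rcases p with x | x <;> rfl
  inv_hom_id := hom_ext fun p => by rcases p with x | x <;> rfl

/-! ### Globular comparison cells for composition, units and tensor product -/

/-- The comparison of `★` with horizontal composition. -/
noncomputable def starCompIso {X Y Z : Type u} (M : OpenHor (RMat.zero.{u} R) X Y)
    (N : OpenHor (RMat.zero.{u} R) Y Z) :
    HorArrow.mk ((gluing R).hcomp (starHor M) (starHor N)) ≅
      HorArrow.mk (starHor ((RMat.gluing R).hcomp M N)) :=
  OpenCell.isoMk (Iso.refl _) (Iso.refl _) (starPushIso M N)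
    -- A point of a foot is sent directly to a representative in the quotient, so the leg equations
    -- compute without a case split.
    (hom_ext fun _ => rfl) (hom_ext fun _ => rfl)

/-- The comparison of `★` with horizontal identities. -/
noncomputable def starUnitIso (R : Type v) [CommMonoid R] [CompleteLattice R] [IsQuantale R]
    (X : Type u) :
    HorArrow.mk (Gluing.hid (one R) X) ≅ HorArrow.mk (starHor (Gluing.hid (RMat.zero R) X)) :=
  OpenCell.isoMk (Iso.refl _) (Iso.refl _) ((oneIso R).app X)
    (hom_ext fun _ => rfl) (hom_ext fun _ => rfl)

/-- The comparison of `★` with the tensor product. -/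
noncomputable def starTensorIso {X Y X' Y' : Type u} (M : OpenHor (RMat.zero.{u} R) X Y)
    (N : OpenHor (RMat.zero.{u} R) X' Y') :
    HorArrow.mk ((gluing R).tensorHor (starHor M) (starHor N)) ≅
      HorArrow.mk (starHor ((RMat.gluing R).tensorHor M N)) :=
  OpenCell.isoMk (Iso.refl _) (Iso.refl _) (pathCopIso M.apex N.apex)
    -- The legs of a tensor product are defined by cases on a disjoint union, so they compute only
    -- after the summand of `p` is known.
    (hom_ext fun p => by rcases p with x | x <;> rfl)
    (hom_ext fun p => by rcases p with x | x <;> rfl)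

/-! ### Naturality and coherence axioms -/

/-- `★` as a double functor. -/
noncomputable def starDoubleFunctor (R : Type v) [CommMonoid R] [CompleteLattice R]
    [IsQuantale R] :
    DoubleFunctor (openRMat.{u} R).toDoubleCategory (openRCat.{u} R).toDoubleCategory where
  toDoubleFunctorData := starData R
  srcMap_cell _ := rfl
  tgtMap_cell _ := rfl
  -- Since $F$ keeps underlying functions, both functoriality laws are definitional on functions;
  -- what remains are proofs of inequalities, which are irrelevant to equality.
  cell_id _ := rfl
  cell_comp _ _ := rfl
  compIso M N := starCompIso M N
  srcMap_compIso _ _ := rfl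
  tgtMap_compIso _ _ := rfl
  -- The comparison has identity feet, so only the apex component has content: on a class coming
  -- from $M$ or from $N$, both sides apply the corresponding cell.
  compIso_naturality α β h h' := OpenCell.hom_ext rfl rfl
    (hom_ext fun p => by rcases p with ⟨x | x⟩ <;> rfl)
  unitIso X := starUnitIso R X
  srcMap_unitIso _ := rfl
  tgtMap_unitIso _ := rfl
  unitIso_naturality _ := OpenCell.hom_ext rfl rfl (hom_ext fun _ => rfl)
  compIso_hassoc M N P h₁ h₂ := OpenCell.hom_ext rfl rfl
    (hom_ext fun p => by
      -- The apex is a pushout whose first member is itself a pushout, so an element of that member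
      -- needs a second choice of representative.
      rcases p with ⟨p | x⟩
      · rcases p with ⟨x | x⟩ <;> rfl
      · rfl)
  compIso_hlunit M h := OpenCell.hom_ext rfl rfl
    -- A point of the unit cospan goes to its image under the input leg of `M` on both sides; a
    -- vertex of `M` goes to itself.
    (hom_ext fun p => by rcases p with ⟨x | x⟩ <;> rfl)
  compIso_hrunit M h := OpenCell.hom_ext rfl rfl
    (hom_ext fun p => by rcases p with ⟨x | x⟩ <;> rfl)

/-- `★` as a symmetric monoidal double functor. -/
noncomputable def starSymMon (R : Type v) [CommMonoid R] [CompleteLattice R]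
    [IsQuantale R] : SymMonDoubleFunctor (openRMat.{u} R) (openRCat.{u} R) where
  toDoubleFunctor := starDoubleFunctor R
  braided := SetSum.braidedId
  tensorIso M N := starTensorIso M N
  srcMap_tensorIso _ _ := rfl
  tgtMap_tensorIso _ _ := rfl
  tensorIso_naturality α β := OpenCell.hom_ext rfl rfl
    (hom_ext fun p => by rcases p with x | x <;> rfl)
  -- The monoidal unit is the horizontal identity on the empty set. As $\varepsilon$ is an identity,
  -- compatibility with horizontal units forces this comparison to be the one already chosen for
  -- them.
  tensorUnitIso := starUnitIso R PEmpty
  srcMap_tensorUnitIso := rfl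
  tgtMap_tensorUnitIso := rfl
  tensorIso_tassoc M N P := OpenCell.hom_ext
    -- Here the feet need an argument too: a disjoint union of identity functions reduces to the
    -- identity only on elements of a known summand.
    (by ext p; rcases p with (x | x) | x <;> rfl) (by ext p; rcases p with (x | x) | x <;> rfl)
    (hom_ext fun p => by rcases p with (x | x) | x <;> rfl)
  tensorIso_tlunit M := OpenCell.hom_ext
    (by ext p; rcases p with x | x <;> rfl) (by ext p; rcases p with x | x <;> rfl)
    -- The summand contributed by the monoidal unit is empty, so that case is vacuous.
    (hom_ext fun p => by rcases p with x | x; exacts [x.elim, rfl])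
  tensorIso_trunit M := OpenCell.hom_ext
    (by ext p; rcases p with x | x <;> rfl) (by ext p; rcases p with x | x <;> rfl)
    (hom_ext fun p => by rcases p with x | x; exacts [rfl, x.elim])
  tensorIso_tbraid M N := OpenCell.hom_ext
    (by ext p; rcases p with x | x <;> rfl) (by ext p; rcases p with x | x <;> rfl)
    (hom_ext fun p => by rcases p with x | x <;> rfl)
  tensorIso_hcomp M₁ N₁ M₂ N₂ h := OpenCell.hom_ext
    (by ext p; rcases p with x | x <;> rfl) (by ext p; rcases p with x | x <;> rfl)
    -- The apex is a pushout of two coproducts; the four cases are vertices of `M₁`, `N₁`, `M₂` and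
    -- `N₂`, and both routes send each to its class in the composite of its own column.
    (hom_ext fun p => by rcases p with ⟨(x | x) | (x | x)⟩ <;> rfl)
  tensorIso_hid X Y := OpenCell.hom_ext
    (by ext p; rcases p with x | x <;> rfl) (by ext p; rcases p with x | x <;> rfl)
    (hom_ext fun p => by rcases p with x | x <;> rfl)
  tensorUnitIso_hid := OpenCell.hom_ext rfl rfl (hom_ext fun _ => rfl)

end RCat

/-- The equation of underlying data encodes requirements 1–3, fixing $\bigstar$ on sets, functions,
open matrices and 2-morphisms. The comparison isomorphisms and all their coherence laws are part of
the type of the witness. -/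
theorem theorem4p3 (R : Type v) [CommMonoid R] [CompleteLattice R] [IsQuantale R] :
    ∃ star : SymMonDoubleFunctor (openRMat.{u} R) (openRCat.{u} R),
      star.toDoubleFunctorData = starData R :=
  -- The double functor was built by adding comparisons and proofs to `starData R`, so forgetting
  -- them returns it definitionally.
  ⟨RCat.starSymMon R, rfl⟩
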